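/- Let $(a;b)_n:=\prod_{j=0}^{n-1}(1-ab^j)$ and $(a)_n:=(a;q)_n$, and define formal power series in $\mathbb{Z}[[q]]$ by $$f_1(q):=\sum_{n\ge 0}\frac{q^{(n^2+n)/2}(q)_{2n}}{(-q)_n(q)_{2n+1}},\qquad f_2(q):=\sum_{n\ge 1}\frac{q^{(n^2+n)/2}(q)_{2n-2}}{(-q)_{n-1}(q)_{2n-1}},$$ $$f_3(q):=\sum_{n\ge 0}\frac{(q)_{2n}}{(-q)_{2n+1}}q^n,\qquad f_4(q):=\sum_{n\ge 0}\frac{(q)_{2n+1}}{(-q)_{2n+2}}q^{n+1},$$ $$f_5(q):=\sum_{n\ge 0}(-1)^n\frac{(q)_n}{(q;q^2)_{n+1}}q^{(n^2+n)/2},\qquad f_6(q):=\sum_{n\ge 1}(-1)^n\frac{(q)_{n-1}(q^2;q^2)_{n-1}}{(q)_{2n-1}}q^n,$$ $$f_7(q):=\sum_{n\ge 0}(-1)^n\frac{q^{n^2+n}(q^2;q^2)_n}{(-q)_{2n+1}},\qquad f_8(q):=\sum_{n\ge 1}\frac{(q)_{2n-1}}{(q^{2n};q^2)_n}q^n.$$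 For $1\le i\le 8$ let $a_{f_i}(n)$ denote the coefficient of $q^n$ in $f_i$, and let $$S_i:=\{m\in\mathbb{Z} : a_{f_i}(n)=m \text{ for infinitely many integers } n\ge 0\}.$$ Then, with $\mathbb{N}_0=\{0,1,2,\dots\}$ and $\mathbb{N}=\{1,2,3,\dots\}$, $$S_i=\begin{cases}\mathbb{N}_0&\text{if } i\in\{1,2,5\},\\ -\mathbb{N}_0&\text{if } i=6,\\ \mathbb{Z}&\text{if } i\in\{4,7\},\\ \mathbb{N}_0\cup -2\mathbb{N}&\text{if } i\in\{3,8\}.\end{cases}$$ -/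

import Mathlib

open scoped PowerSeries.WithPiTopology

noncomputable section

/-- The indeterminate `q` of the ring `ℤ⟦q⟧` of formal power series. -/
abbrev q : PowerSeries ℤ := PowerSeries.X

/-- The `q`-Pochhammer symbol `(a;b)_n = ∏_{j=0}^{n-1} (1 - a b^j)` with base `b`. -/
def poch (a b : PowerSeries ℤ) (n : ℕ) : PowerSeries ℤ :=
  ∏ j ∈ Finset.range n, (1 - a * b ^ j)

/-- The quotient `g / h` in `ℤ⟦q⟧` of formal power series, for `h` with constant term `1`. -/
def quot (g h : PowerSeries ℤ) : PowerSeries ℤ :=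
  g * PowerSeries.invOfUnit h 1

theorem quot_mul {g h : PowerSeries ℤ} (hh : PowerSeries.constantCoeff h = 1) :
    quot g h * h = g := by
  rw [quot, mul_assoc, PowerSeries.invOfUnit_mul h 1 (by simpa using hh), mul_one]

theorem constantCoeff_poch {a : PowerSeries ℤ} (ha : PowerSeries.constantCoeff a = 0)
    (b : PowerSeries ℤ) (n : ℕ) : PowerSeries.constantCoeff (poch a b n) = 1 := by
  simp [poch, map_prod, ha]

/-- The `n`-th term `q^{(n²+n)/2} (q)_{2n} / ((-q)_n (q)_{2n+1})` of `f₁`. -/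
def term1 (n : ℕ) : PowerSeries ℤ :=
  quot (q ^ ((n ^ 2 + n) / 2) * poch q q (2 * n)) (poch (-q) q n * poch q q (2 * n + 1))

/-- The `n`-th term `q^{(n²+n)/2} (q)_{2n-2} / ((-q)_{n-1} (q)_{2n-1})` of `f₂`, for `n ≥ 1`. -/
def term2 (n : ℕ) : PowerSeries ℤ :=
  quot (q ^ ((n ^ 2 + n) / 2) * poch q q (2 * n - 2)) (poch (-q) q (n - 1) * poch q q (2 * n - 1))

/-- The `n`-th term `(q)_{2n} / (-q)_{2n+1} q^n` of `f₃`. -/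
def term3 (n : ℕ) : PowerSeries ℤ :=
  quot (poch q q (2 * n)) (poch (-q) q (2 * n + 1)) * q ^ n

/-- The `n`-th term `(q)_{2n+1} / (-q)_{2n+2} q^{n+1}` of `f₄`. -/
def term4 (n : ℕ) : PowerSeries ℤ :=
  quot (poch q q (2 * n + 1)) (poch (-q) q (2 * n + 2)) * q ^ (n + 1)

/-- The `n`-th term `(-1)^n (q)_n / (q;q²)_{n+1} q^{(n²+n)/2}` of `f₅`. -/
def term5 (n : ℕ) : PowerSeries ℤ :=
  (-1) ^ n * quot (poch q q n) (poch q (q ^ 2) (n + 1)) * q ^ ((n ^ 2 + n) / 2)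

/-- The `n`-th term `(-1)^n (q)_{n-1} (q²;q²)_{n-1} / (q)_{2n-1} q^n` of `f₆`, for `n ≥ 1`. -/
def term6 (n : ℕ) : PowerSeries ℤ :=
  (-1) ^ n * quot (poch q q (n - 1) * poch (q ^ 2) (q ^ 2) (n - 1)) (poch q q (2 * n - 1)) * q ^ n

/-- The `n`-th term `(-1)^n q^{n²+n} (q²;q²)_n / (-q)_{2n+1}` of `f₇`. -/
def term7 (n : ℕ) : PowerSeries ℤ :=
  (-1) ^ n * quot (q ^ (n ^ 2 + n) * poch (q ^ 2) (q ^ 2) n) (poch (-q) q (2 * n + 1))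

/-- The `n`-th term `(q)_{2n-1} / (q^{2n};q²)_n q^n` of `f₈`, for `n ≥ 1`. -/
def term8 (n : ℕ) : PowerSeries ℤ :=
  quot (poch q q (2 * n - 1)) (poch (q ^ (2 * n)) (q ^ 2) n) * q ^ n

/-! The series themselves; sums converge coefficientwise, that is, in the product topology of
`ℤ⟦q⟧` with `ℤ` discrete. A sum over `n ≥ 1` is written as a sum over `m ≥ 0` with `n = m + 1`. -/

def f₁ : PowerSeries ℤ := ∑' n : ℕ, term1 n
def f₂ : PowerSeries ℤ := ∑' m : ℕ, term2 (m + 1)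
def f₃ : PowerSeries ℤ := ∑' n : ℕ, term3 n
def f₄ : PowerSeries ℤ := ∑' n : ℕ, term4 n
def f₅ : PowerSeries ℤ := ∑' n : ℕ, term5 n
def f₆ : PowerSeries ℤ := ∑' m : ℕ, term6 (m + 1)
def f₇ : PowerSeries ℤ := ∑' n : ℕ, term7 n
def f₈ : PowerSeries ℤ := ∑' m : ℕ, term8 (m + 1)

/-- The set of integers `m` such that `a_f(n) = m` for infinitely many `n`, where `a_f(n)` is
the `n`-th coefficient of `f`. -/
def infinitelyAttained (f : PowerSeries ℤ) : Set ℤ :=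
  {m : ℤ | {n : ℕ | PowerSeries.coeff n f = m}.Infinite}

/-! All eight sums converge, and all denominators have constant term `1`. -/

theorem summable_of_dvd {t : ℕ → PowerSeries ℤ} (h : ∀ n, q ^ n ∣ t n) : Summable t := by
  rw [PowerSeries.WithPiTopology.summable_iff_summable_coeff]
  intro d
  refine summable_of_ne_finset_zero (s := Finset.range (d + 1)) fun n hn => ?_
  exact PowerSeries.X_pow_dvd_iff.mp (h n) d (by simpa using hn)

theorem le_half (n : ℕ) : n ≤ (n ^ 2 + n) / 2 := by
  rw [Nat.le_div_iff_mul_le two_pos]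
  nlinarith [Nat.le_self_pow two_ne_zero n]

theorem summable_terms :
    Summable term1 ∧ Summable (fun m => term2 (m + 1)) ∧ Summable term3 ∧ Summable term4 ∧
      Summable term5 ∧ Summable (fun m => term6 (m + 1)) ∧ Summable term7 ∧
      Summable (fun m => term8 (m + 1)) := by
  refine ⟨?_, ?_, ?_, ?_, ?_, ?_, ?_, ?_⟩ <;> refine summable_of_dvd fun n => ?_
  · exact ((pow_dvd_pow q (le_half n)).mul_right _).mul_right _
  · exact ((pow_dvd_pow q ((Nat.le_succ n).trans (le_half (n + 1)))).mul_right _).mul_right _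
  · exact dvd_mul_left _ _
  · exact (pow_dvd_pow q (Nat.le_succ n)).mul_left _
  · exact (pow_dvd_pow q (le_half n)).mul_left _
  · exact (pow_dvd_pow q (Nat.le_succ n)).mul_left _
  · exact (((pow_dvd_pow q (Nat.le_add_left n (n ^ 2))).mul_right _).mul_right _).mul_left _
  · exact (pow_dvd_pow q (Nat.le_succ n)).mul_left _

theorem constantCoeff_denominators (n : ℕ) :
    PowerSeries.constantCoeff (poch (-q) q n * poch q q (2 * n + 1)) = 1 ∧
    PowerSeries.constantCoeff (poch (-q) q (n - 1) * poch q q (2 * n - 1)) = 1 ∧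
    PowerSeries.constantCoeff (poch (-q) q (2 * n + 1)) = 1 ∧
    PowerSeries.constantCoeff (poch (-q) q (2 * n + 2)) = 1 ∧
    PowerSeries.constantCoeff (poch q (q ^ 2) (n + 1)) = 1 ∧
    PowerSeries.constantCoeff (poch q q (2 * n - 1)) = 1 ∧
    (1 ≤ n → PowerSeries.constantCoeff (poch (q ^ (2 * n)) (q ^ 2) n) = 1) := by
  refine ⟨?_, ?_, ?_, ?_, ?_, ?_, fun hn => ?_⟩
  all_goals try rw [map_mul]
  all_goals repeat rw [constantCoeff_poch]
  all_goals simp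
  omega

end

/-! ### Counting representations by `m x² - w²` in a fundamental cone -/

section OrbitCounting

variable {V : Type*}

/-! Every coefficient is, up to sign, a number of lattice points. For `m = 2` (`f₁` to `f₄`) or `m =
3` (`f₅` to `f₈`), the coefficient of `q^d` is `±coneCount m N`, the number of `(x, w)` with `-x < w
≤ x` and `m x² - w² = N`, where `N` is an affine function of `d` (for `f₂`, of `d ≥ 1`) and the sign
is constant or alternates with `d`.

These formulas come from Bailey's lemma. The `n`-th term of each series is written `δ_n β_n` with
`β_n = ∑ W_r k(n, r)`; interchanging the summations gives `∑ W_r γ_r`, where `γ_r = ∑ δ_n k(n, r)`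
is explicit and `W_r` is a partial theta-like sum times an elementary factor. The resulting double
sum has an indefinite quadratic form as exponent, and completing squares gives the cone. The series
`f₁` and `f₂` are the even and odd parts of one such sum.

The cone is a fundamental domain for the unit `3 + 2√2`, respectively `2 + √3`, on the branch `x >
0` of the hyperbola, so `coneCount` counts the elements `w + x√m` of norm `-N` with `x > 0` up to
powers of this unit. The arithmetic of `ℤ[√m]` then gives multiplicativity: a factor `p^k` prime to
the rest, with `p = 17` or `13` split, multiplies the count by `k + 1` (`coneCount_mul_pow`); a
square factor `l²` with `l = 3` or `5` inert changes nothing, and `l` dividing `N` exactly once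
makes the count zero.

Since `17` and `81` are `1` modulo `16`, and `13` and `25` are `1` modulo `12`, multiplying a
starting level by these numbers stays in the required progression. Starting levels with count `1` or
`2` and the right sign thus give all listed nonzero values infinitely often. For `f₃` and `f₈` the
negative coefficients are even because the reflection `w ↦ -w` acts without fixed points on the
relevant cone points. -/

theorem perm_zpow_comm (T : Equiv.Perm V) (f : V → V) (hfT : ∀ v, f (T v) = T (f v)) (i : ℤ)
    (v : V) : f ((T ^ i) v) = (T ^ i) (f v) := by
  have hnat : ∀ (n : ℕ) v, f ((T ^ n) v) = (T ^ n) (f v) := by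
    intro n
    induction n with
    | zero => simp
    | succ n ih =>
      intro v
      rw [pow_succ, Equiv.Perm.mul_apply, ih, hfT, Equiv.Perm.mul_apply]
  obtain ⟨n, rfl | rfl⟩ := i.eq_nat_or_neg
  · exact_mod_cast hnat n v
  · have h := hnat n ((T ^ (-(n : ℤ))) v)
    rw [← zpow_natCast, ← Equiv.Perm.mul_apply, ← zpow_add, add_neg_cancel, zpow_zero,
      Equiv.Perm.one_apply] at h
    rw [h, ← Equiv.Perm.mul_apply, ← zpow_add, neg_add_cancel, zpow_zero, Equiv.Perm.one_apply]

/-- Orbits of `T` inside an invariant set `A` and inside its image under an injective map commuting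
with `T` are equinumerous, counted in a fundamental domain `S`. -/
theorem ncard_inter_image (T : Equiv.Perm V) (S P A : Set V) (f : V → V)
    (hf : Function.Injective f) (hfT : ∀ v, f (T v) = T (f v))
    (hex : ∀ v ∈ P, ∃ i : ℤ, (T ^ i) v ∈ S)
    (huniq : ∀ v ∈ S, ∀ i : ℤ, (T ^ i) v ∈ S → i = 0)
    (hA : ∀ v ∈ A, ∀ i : ℤ, (T ^ i) v ∈ A) (hAP : A ⊆ P) (hfA : f '' A ⊆ P) :
    (S ∩ f '' A).ncard = (S ∩ A).ncard := by
  choose! i hi using hex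
  have hc := perm_zpow_comm T f hfT
  symm
  -- A point goes to the translate of its image that lies in `S`. Uniqueness of representatives
  -- gives injectivity, and translating a preimage back into `S` gives surjectivity.
  refine Set.ncard_congr (fun v _ => (T ^ i (f v)) (f v)) ?_ ?_ ?_
  · rintro v ⟨-, hv⟩
    refine ⟨hi _ (hfA ⟨v, hv, rfl⟩), ?_⟩
    rw [← hc]
    exact ⟨_, hA v hv _, rfl⟩
  · rintro v w ⟨hvS, hv⟩ ⟨hwS, hw⟩ h
    simp only [← hc] at h
    have h1 := hf h
    have h2 : w = (T ^ (-i (f w) + i (f v))) v := by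
      rw [zpow_add, Equiv.Perm.mul_apply, h1, ← Equiv.Perm.mul_apply, ← zpow_add,
        neg_add_cancel, zpow_zero, Equiv.Perm.one_apply]
    have h3 := huniq v hvS _ (h2 ▸ hwS)
    rw [h3] at h2
    simpa using h2.symm
  · rintro _ ⟨hbS, a, ha, rfl⟩
    refine ⟨(T ^ i a) a, ⟨hi a (hAP ha), hA a ha _⟩, ?_⟩
    have hmem : f ((T ^ i a) a) ∈ P := hfA ⟨_, hA a ha _, rfl⟩
    have h1 := hi _ hmem
    set k := i (f ((T ^ i a) a)) with hk
    rw [hc, ← Equiv.Perm.mul_apply, ← zpow_add] at h1 ⊢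
    rw [huniq _ hbS _ h1]
    simp

end OrbitCounting

/-- The points of the cone `-x < w ≤ x` with `m x² - w² = N`. -/
def conePts (m N : ℤ) : Set (ℤ × ℤ) :=
  {v | -v.1 < v.2 ∧ v.2 ≤ v.1 ∧ m * v.1 ^ 2 - v.2 ^ 2 = N}

/-- The number of points of the cone `-x < w ≤ x` with `m x² - w² = N`. -/
noncomputable def coneCount (m N : ℤ) : ℕ := (conePts m N).ncard

/-- On the cone `w² ≤ x²`, hence `(m - 1) x² ≤ N`. -/
theorem conePts_bound {m N : ℤ} (hm : 2 ≤ m) {v : ℤ × ℤ} (hv : v ∈ conePts m N) :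
    0 < v.1 ∧ v.1 ≤ N := by
  obtain ⟨h1, h2, h3⟩ := hv
  have hx : 0 < v.1 := by linarith
  refine ⟨hx, ?_⟩
  nlinarith [mul_nonneg (sub_nonneg.2 h2) (by linarith : 0 ≤ v.1 + v.2),
    mul_nonneg (sub_nonneg.2 hm) (sq_nonneg v.1)]

theorem conePts_finite {m N : ℤ} (hm : 2 ≤ m) : (conePts m N).Finite := by
  refine Set.Finite.subset ((Set.finite_Icc (0 : ℤ) N).prod (Set.finite_Icc (-N) N)) ?_
  intro v hv
  obtain ⟨h0, hN⟩ := conePts_bound hm hv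
  obtain ⟨h1, h2, -⟩ := hv
  simp only [Set.mem_prod, Set.mem_Icc]
  exact ⟨⟨h0.le, hN⟩, by linarith, by linarith⟩

/-- The points `(x, w)` with `x > 0` on the hyperbola `m x² - w² = N`. -/
def hyperbolaPts (m N : ℤ) : Set (ℤ × ℤ) := {v | 0 < v.1 ∧ m * v.1 ^ 2 - v.2 ^ 2 = N}

/-- Half-open because the unit maps the boundary ray `w = -x` onto the ray `w = x`. -/
def cone : Set (ℤ × ℤ) := {v | -v.1 < v.2 ∧ v.2 ≤ v.1}

theorem conePts_eq (m N : ℤ) : conePts m N = cone ∩ hyperbolaPts m N := by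
  ext v
  simp only [conePts, cone, hyperbolaPts, Set.mem_inter_iff, Set.mem_ofPred_eq]
  constructor
  · rintro ⟨h1, h2, h3⟩
    exact ⟨⟨h1, h2⟩, by linarith, h3⟩
  · rintro ⟨⟨h1, h2⟩, -, h3⟩
    exact ⟨h1, h2, h3⟩

/-! ### The cone as a fundamental domain for a unit of norm one -/

section UnitAction

variable {m u : ℤ}

/-- Multiplication by the unit `(u + 1) + u √m`, where `m u = u + 2`. -/
def unitPerm (m u : ℤ) (_ : m * u = u + 2) : Equiv.Perm (ℤ × ℤ) where
  toFun v := ((u + 1) * v.1 + u * v.2, (u + 2) * v.1 + (u + 1) * v.2)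
  invFun v := ((u + 1) * v.1 - u * v.2, (u + 1) * v.2 - (u + 2) * v.1)
  left_inv v := by ext <;> simp <;> ring
  right_inv v := by ext <;> simp <;> ring

/-- Here `a² x² - b² w² = p x² + b² N > 0`. It follows that multiplication by `a ± b√m` keeps the
branch `x > 0`. -/
theorem lt_of_hyperbola {m a b p x w N : ℤ} (ha : 0 < a) (hab : a ^ 2 - m * b ^ 2 = p) (hp : 0 < p)
    (hx : 0 < x) (h : m * x ^ 2 - w ^ 2 = N) (hN : 0 < N) : |b * w| < a * x := by
  apply abs_lt_of_sq_lt_sq _ (by positivity)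
  nlinarith [mul_nonneg (sq_nonneg b) hN.le, mul_pos hp (sq_pos_of_pos hx)]

variable (hmu : m * u = u + 2) (hu : 0 < u)

include hmu hu

theorem unitPerm_mem {N : ℤ} (hN : 0 < N) {v : ℤ × ℤ} (hv : v ∈ hyperbolaPts m N) :
    unitPerm m u hmu v ∈ hyperbolaPts m N ∧ (unitPerm m u hmu)⁻¹ v ∈ hyperbolaPts m N := by
  obtain ⟨hx, h⟩ := hv
  have hlt := lt_of_hyperbola (a := u + 1) (b := u) (p := 1) (by linarith)
    (by linear_combination -u * hmu) one_pos hx h hN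
  rw [abs_lt] at hlt
  refine ⟨⟨?_, ?_⟩, ?_, ?_⟩
  · simp only [unitPerm, Equiv.coe_fn_mk]; linarith
  · simp only [unitPerm, Equiv.coe_fn_mk]
    linear_combination h + (u * v.1 ^ 2 + v.2 ^ 2 * u + 2 * (u + 1) * v.1 * v.2 + 2 * v.1 ^ 2) * hmu
  · show 0 < (u + 1) * v.1 - u * v.2
    linarith
  · show m * ((u + 1) * v.1 - u * v.2) ^ 2 - ((u + 1) * v.2 - (u + 2) * v.1) ^ 2 = N
    linear_combination h + (u * v.1 ^ 2 + v.2 ^ 2 * u - 2 * (u + 1) * v.1 * v.2 + 2 * v.1 ^ 2) * hmu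

theorem unitPerm_zpow_mem {N : ℤ} (hN : 0 < N) {v : ℤ × ℤ} (hv : v ∈ hyperbolaPts m N) (i : ℤ) :
    (unitPerm m u hmu ^ i) v ∈ hyperbolaPts m N := by
  induction i with
  | zero => simpa using hv
  | succ n ih =>
    rw [add_comm, zpow_add, zpow_one, Equiv.Perm.mul_apply]
    exact (unitPerm_mem hmu hu hN ih).1
  | pred n ih =>
    rw [sub_eq_add_neg, add_comm, zpow_add, zpow_neg_one, Equiv.Perm.mul_apply]
    exact (unitPerm_mem hmu hu hN ih).2

/-- Descent on `x`: below the cone the unit lowers `x`, above the cone its inverse does. -/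
theorem exists_zpow_mem_cone {N : ℤ} (hN : 0 < N) {v : ℤ × ℤ} (hv : v ∈ hyperbolaPts m N) :
    ∃ i : ℤ, (unitPerm m u hmu ^ i) v ∈ cone := by
  induction _hn : v.1.toNat using Nat.strong_induction_on generalizing v with
  | _ n ih =>
    have hx := hv.1
    obtain ⟨hT, hT'⟩ := unitPerm_mem hmu hu hN hv
    rcases lt_trichotomy v.2 (-v.1) with h1 | h1 | h1
    · have hlt : (unitPerm m u hmu v).1 < v.1 := by
        show (u + 1) * v.1 + u * v.2 < v.1
        nlinarith
      obtain ⟨i, hi⟩ := ih _ (by have := hT.1; omega) hT rfl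
      refine ⟨i + 1, ?_⟩
      rwa [zpow_add, zpow_one, Equiv.Perm.mul_apply]
    -- On the excluded ray `w = -x` one application of the unit lands on `w = x`.
    · refine ⟨1, ?_⟩
      rw [zpow_one]
      simp only [unitPerm, Equiv.coe_fn_mk, cone, Set.mem_ofPred_eq, h1]
      constructor <;> linarith
    · rcases le_or_gt v.2 v.1 with h2 | h2
      · exact ⟨0, by simpa using ⟨h1, h2⟩⟩
      · have hlt : ((unitPerm m u hmu)⁻¹ v).1 < v.1 := by
          show (u + 1) * v.1 - u * v.2 < v.1
          nlinarith
        obtain ⟨i, hi⟩ := ih _ (by have := hT'.1; omega) hT' rfl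
        refine ⟨i - 1, ?_⟩
        rwa [zpow_sub_one, Equiv.Perm.mul_apply]

/-- The unit sends the cone into the region `0 < x < w`, and that region into itself, so no positive
power returns to the cone. A negative power is a positive one read from the image. -/
theorem zpow_mem_cone_unique {v : ℤ × ℤ} (hv : v ∈ cone) {i : ℤ}
    (hi : (unitPerm m u hmu ^ i) v ∈ cone) : i = 0 := by
  have key : ∀ v ∈ cone, ∀ n : ℕ, 0 < ((unitPerm m u hmu ^ (n + 1)) v).1 ∧
      ((unitPerm m u hmu ^ (n + 1)) v).1 < ((unitPerm m u hmu ^ (n + 1)) v).2 := by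
    intro v hv n
    induction n with
    | zero =>
      obtain ⟨h1, h2⟩ := hv
      rw [zero_add, pow_one]
      simp only [unitPerm, Equiv.coe_fn_mk]
      constructor <;> nlinarith
    | succ n ih =>
      rw [pow_succ', Equiv.Perm.mul_apply]
      generalize (unitPerm m u hmu ^ (n + 1)) v = w at ih
      obtain ⟨h1, h2⟩ := ih
      simp only [unitPerm, Equiv.coe_fn_mk]
      constructor <;> nlinarith
  rcases lt_trichotomy i 0 with h | h | h
  · obtain ⟨n, rfl⟩ : ∃ n : ℕ, i = -((n + 1 : ℕ) : ℤ) := ⟨(-i - 1).toNat, by omega⟩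
    have h1 := key _ hi n
    rw [← zpow_natCast, ← Equiv.Perm.mul_apply, ← zpow_add, add_neg_cancel, zpow_zero,
      Equiv.Perm.one_apply] at h1
    exact absurd hv.2 (not_le.2 h1.2)
  · exact h
  · obtain ⟨n, rfl⟩ : ∃ n : ℕ, i = ((n + 1 : ℕ) : ℤ) := ⟨(i - 1).toNat, by omega⟩
    rw [zpow_natCast] at hi
    exact absurd hi.2 (not_le.2 (key v hv n).2)

/-- Multiplication by a similitude commuting with the unit preserves the number of orbits. -/
theorem ncard_cone_inter_image {N M : ℤ} (hN : 0 < N) (hM : 0 < M) (f : ℤ × ℤ → ℤ × ℤ)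
    (hf : Function.Injective f) (hfT : ∀ v, f (unitPerm m u hmu v) = unitPerm m u hmu (f v))
    (hfN : ∀ v ∈ hyperbolaPts m N, f v ∈ hyperbolaPts m M) :
    (cone ∩ f '' hyperbolaPts m N).ncard = coneCount m N := by
  rw [coneCount, conePts_eq]
  refine ncard_inter_image (unitPerm m u hmu) cone (hyperbolaPts m N ∪ hyperbolaPts m M) _ f hf hfT
    ?_ (fun v hv i hi => zpow_mem_cone_unique hmu hu hv hi)
    (fun v hv i => unitPerm_zpow_mem hmu hu hN hv i) Set.subset_union_left ?_
  · rintro v (hv | hv)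
    · exact exists_zpow_mem_cone hmu hu hN hv
    · exact exists_zpow_mem_cone hmu hu hM hv
  · rintro _ ⟨v, hv, rfl⟩
    exact Or.inr (hfN v hv)

end UnitAction

/-- Multiplication by `g + h √m`. -/
def simil (m g h : ℤ) (v : ℤ × ℤ) : ℤ × ℤ := (g * v.1 + h * v.2, m * h * v.1 + g * v.2)

/-! ### Split primes: a factor `p^k` multiplies the count by `k + 1` -/

section SplitPrime

variable {m u g h p : ℤ}

theorem simil_unitPerm (hmu : m * u = u + 2) (v : ℤ × ℤ) :
    simil m g h (unitPerm m u hmu v) = unitPerm m u hmu (simil m g h v) := by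
  ext <;> simp only [simil, unitPerm, Equiv.coe_fn_mk]
  · linear_combination -h * v.1 * hmu
  · linear_combination h * v.2 * hmu

theorem simil_simil_neg (hp : g ^ 2 - m * h ^ 2 = p) (v : ℤ × ℤ) :
    simil m g h (simil m g (-h) v) = (p * v.1, p * v.2) := by
  subst hp
  ext <;> simp only [simil] <;> ring

theorem simil_injective (hp : g ^ 2 - m * h ^ 2 = p) (hp0 : 0 < p) :
    Function.Injective (simil m g h) := by
  intro v w hvw
  have h1 := simil_simil_neg (m := m) (g := g) (h := -h) (p := p) (by rw [neg_sq]; exact hp) v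
  have h2 := simil_simil_neg (m := m) (g := g) (h := -h) (p := p) (by rw [neg_sq]; exact hp) w
  rw [neg_neg, hvw] at h1
  rw [neg_neg] at h2
  have h3 := h1.symm.trans h2
  rw [Prod.mk.injEq] at h3
  ext
  · exact mul_left_cancel₀ hp0.ne' h3.1
  · exact mul_left_cancel₀ hp0.ne' h3.2

theorem simil_mem (hg : 0 < g) (hp : g ^ 2 - m * h ^ 2 = p) (hp0 : 0 < p) {N : ℤ} (hN : 0 < N)
    {v : ℤ × ℤ} (hv : v ∈ hyperbolaPts m N) : simil m g h v ∈ hyperbolaPts m (p * N) := by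
  have hlt := lt_of_hyperbola hg hp hp0 hv.1 hv.2 hN
  rw [abs_lt] at hlt
  refine ⟨?_, ?_⟩
  · simp only [simil]; linarith
  · simp only [simil]; rw [← hp, ← hv.2]; ring

/-- Since `(g + h√m)(g - h√m) = p`, being a multiple of `g + h√m` amounts to having a product with
`g - h√m` divisible by `p`. -/
theorem simil_image {N : ℤ} (hg : 0 < g) (hp : g ^ 2 - m * h ^ 2 = p) (hp0 : 0 < p) (hN : 0 < N) :
    simil m g h '' hyperbolaPts m N =
      {v | v ∈ hyperbolaPts m (p * N) ∧ p ∣ (simil m g (-h) v).1 ∧ p ∣ (simil m g (-h) v).2} := by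
  ext v
  constructor
  · rintro ⟨v, hv, rfl⟩
    refine ⟨simil_mem hg hp hp0 hN hv, ?_⟩
    have := simil_simil_neg (m := m) (g := g) (h := -h) (p := p) (by rw [neg_sq]; exact hp) v
    rw [neg_neg] at this
    rw [this]
    exact ⟨dvd_mul_right _ _, dvd_mul_right _ _⟩
  · rintro ⟨hv, ⟨x, hx⟩, ⟨w, hw⟩⟩
    have hs := simil_simil_neg hp v
    have hmem := simil_mem (h := -h) hg (p := p) (by rw [neg_sq]; exact hp) hp0 (mul_pos hp0 hN) hv
    have he : simil m g (-h) v = (p * x, p * w) := Prod.ext hx hw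
    rw [he] at hs hmem
    have hs' : simil m g h (p * x, p * w) = (p * (simil m g h (x, w)).1, p * (simil m g h (x, w)).2) := by
      ext <;> simp only [simil] <;> ring
    rw [hs', Prod.mk.injEq] at hs
    refine ⟨(x, w), ⟨pos_of_mul_pos_right hmem.1 hp0.le, ?_⟩, Prod.ext
      (mul_left_cancel₀ hp0.ne' hs.1) (mul_left_cancel₀ hp0.ne' hs.2)⟩
    have h2 := hmem.2
    have hpp : p * p ≠ 0 := (mul_pos hp0 hp0).ne'
    apply mul_left_cancel₀ hpp
    simp only at h2 ⊢
    linear_combination h2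

variable (hmu : m * u = u + 2) (hu : 0 < u) (hm : 2 ≤ m) (hg : 0 < g)
  (hp : g ^ 2 - m * h ^ 2 = p) (hp0 : 0 < p)
  (hdiv : ∀ x w : ℤ, p ∣ m * x ^ 2 - w ^ 2 → (p ∣ g * x + h * w ∧ p ∣ m * h * x + g * w) ∨
    (p ∣ g * x + -h * w ∧ p ∣ m * -h * x + g * w))
  (hboth : ∀ x w : ℤ, p ∣ g * x + h * w → p ∣ g * x + -h * w → p ∣ m * h * x + g * w →
    p ∣ m * -h * x + g * w → p ∣ x ∧ p ∣ w)

include hmu hu hm hg hp hp0 hdiv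

/-- By `hdiv` every point of level `p N` is a multiple of `g + h√m` or of its conjugate. Each of the
two images has as many orbits as level `N`, and inclusion-exclusion counts their union. -/
theorem coneCount_mul_aux {N : ℤ} (hN : 0 < N) :
    coneCount m (p * N) + (cone ∩ (simil m g h '' hyperbolaPts m N ∩
      simil m g (-h) '' hyperbolaPts m N)).ncard = 2 * coneCount m N := by
  have hp' : g ^ 2 - m * (-h) ^ 2 = p := by rw [neg_sq]; exact hp
  have hpN := mul_pos hp0 hN
  have hunion : hyperbolaPts m (p * N) =
      simil m g h '' hyperbolaPts m N ∪ simil m g (-h) '' hyperbolaPts m N := by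
    rw [simil_image hg hp hp0 hN, simil_image hg hp' hp0 hN, neg_neg]
    ext v
    constructor
    · intro hv
      -- The alternatives cross over: divisibility after multiplication by `g + h√m` detects the
      -- image of `g - h√m`.
      rcases hdiv v.1 v.2 (hv.2 ▸ dvd_mul_right _ _) with hd | hd
      · exact Or.inr ⟨hv, hd⟩
      · exact Or.inl ⟨hv, hd⟩
    · rintro (hv | hv) <;> exact hv.1
  have h1 := ncard_cone_inter_image hmu hu hN hpN _ (simil_injective hp hp0)
    (simil_unitPerm hmu) (fun v hv => simil_mem hg hp hp0 hN hv)
  have h2 := ncard_cone_inter_image hmu hu hN hpN _ (simil_injective hp' hp0)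
    (simil_unitPerm hmu) (fun v hv => simil_mem hg hp' hp0 hN hv)
  have hfin : (cone ∩ hyperbolaPts m (p * N)).Finite := by
    rw [← conePts_eq]; exact conePts_finite hm
  rw [hunion, Set.inter_union_distrib_left] at hfin
  have h3 := Set.ncard_union_add_ncard_inter _ _ (hfin.subset Set.subset_union_left)
    (hfin.subset Set.subset_union_right)
  rw [coneCount, conePts_eq, hunion, Set.inter_union_distrib_left, Set.inter_inter_distrib_left, h3,
    h1, h2, two_mul]

include hboth

/-- A point common to both images is divisible by `p`, so `p²` would divide `p N`. -/
theorem coneCount_mul_of_not_dvd {N : ℤ} (hN : 0 < N) (hpN : ¬ p ∣ N) :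
    coneCount m (p * N) = 2 * coneCount m N := by
  have hc := coneCount_mul_aux hmu hu hm hg hp hp0 hdiv hN
  suffices h0 : simil m g h '' hyperbolaPts m N ∩ simil m g (-h) '' hyperbolaPts m N = ∅ by
    rwa [h0, Set.inter_empty, Set.ncard_empty, add_zero] at hc
  rw [simil_image hg hp hp0 hN, simil_image hg (p := p) (by rw [neg_sq]; exact hp) hp0 hN, neg_neg]
  rw [Set.eq_empty_iff_forall_notMem]
  rintro v ⟨⟨hv, a1, a2⟩, -, b1, b2⟩
  obtain ⟨⟨x, hx⟩, ⟨w, hw⟩⟩ := hboth v.1 v.2 b1 a1 b2 a2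
  apply hpN
  refine ⟨m * x ^ 2 - w ^ 2, mul_left_cancel₀ hp0.ne' ?_⟩
  rw [← hv.2, hx, hw]
  ring

/-- At level `p² N` the two images meet exactly in the multiples of `p`, which are the scaled points
of level `N`. -/
theorem coneCount_mul_mul {N : ℤ} (hN : 0 < N) :
    coneCount m (p * (p * N)) + coneCount m N = 2 * coneCount m (p * N) := by
  have hp' : g ^ 2 - m * (-h) ^ 2 = p := by rw [neg_sq]; exact hp
  have hpN := mul_pos hp0 hN
  rw [← coneCount_mul_aux hmu hu hm hg hp hp0 hdiv hpN]
  congr 1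
  have himg : simil m g h '' hyperbolaPts m (p * N) ∩ simil m g (-h) '' hyperbolaPts m (p * N) =
      (simil m g h ∘ simil m g (-h)) '' hyperbolaPts m N := by
    ext v
    constructor
    · rw [simil_image hg hp hp0 hpN, simil_image hg hp' hp0 hpN, neg_neg]
      rintro ⟨⟨hv, a1, a2⟩, -, b1, b2⟩
      obtain ⟨⟨x, hx⟩, ⟨w, hw⟩⟩ := hboth v.1 v.2 b1 a1 b2 a2
      have h1 := hv.1
      refine ⟨(x, w), ⟨pos_of_mul_pos_right (hx ▸ h1) hp0.le, ?_⟩, ?_⟩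
      · apply mul_left_cancel₀ (mul_pos hp0 hp0).ne'
        have h2 := hv.2
        rw [hx, hw] at h2
        linear_combination h2
      · rw [Function.comp_apply, simil_simil_neg hp]
        exact (Prod.ext hx hw).symm
    · rintro ⟨v, hv, rfl⟩
      refine ⟨⟨_, simil_mem hg hp' hp0 hN hv, rfl⟩, ⟨_, simil_mem hg hp hp0 hN hv, ?_⟩⟩
      have := simil_simil_neg hp' v
      rw [neg_neg] at this
      rw [this, Function.comp_apply, simil_simil_neg hp]
  rw [himg]
  symm
  refine ncard_cone_inter_image hmu hu hN (mul_pos hp0 hpN) _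
    ((simil_injective hp hp0).comp (simil_injective hp' hp0)) (fun v => ?_)
    (fun v hv => simil_mem hg hp hp0 hpN (simil_mem hg hp' hp0 hN hv))
  simp only [Function.comp_apply, simil_unitPerm]

/-- The counts have vanishing second difference in `k` and begin with `c, 2c`, so they form an
arithmetic progression. -/
theorem coneCount_mul_pow {N : ℤ} (hN : 0 < N) (hpN : ¬ p ∣ N) (k : ℕ) :
    coneCount m (p ^ k * N) = (k + 1) * coneCount m N := by
  induction k using Nat.strong_induction_on with
  | _ k ih =>
    match k with
    | 0 => simp
    | 1 => rw [pow_one, coneCount_mul_of_not_dvd hmu hu hm hg hp hp0 hdiv hboth hN hpN]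
    | k + 2 =>
      have h := coneCount_mul_mul hmu hu hm hg hp hp0 hdiv hboth
        (mul_pos (pow_pos hp0 k) hN)
      rw [← mul_assoc p (p ^ k), ← pow_succ', ← mul_assoc, ← pow_succ', ih k (by omega),
        ih (k + 1) (by omega)] at h
      linarith

end SplitPrime

/-! ### Inert primes -/

section InertPrime

variable {m l : ℤ} (hl : 1 < l)
  (hdiv : ∀ x w : ℤ, l ∣ m * x ^ 2 - w ^ 2 → l ∣ x ∧ l ∣ w)

include hdiv

theorem coneCount_inert_zero {N : ℤ} (h1 : l ∣ N) (h2 : ¬ l ^ 2 ∣ N) : coneCount m N = 0 := by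
  suffices h0 : conePts m N = ∅ by rw [coneCount, h0, Set.ncard_empty]
  rw [Set.eq_empty_iff_forall_notMem]
  rintro v ⟨-, -, hv⟩
  obtain ⟨⟨x, hx⟩, ⟨w, hw⟩⟩ := hdiv v.1 v.2 (hv ▸ h1)
  apply h2
  rw [← hv, hx, hw]
  exact ⟨m * x ^ 2 - w ^ 2, by ring⟩

include hl

/-- Every solution at level `l² N` is divisible by `l`, and scaling by `l > 0` preserves the cone in
both directions. -/
theorem coneCount_inert_mul (N : ℤ) : coneCount m (l ^ 2 * N) = coneCount m N := by
  have hl0 : l ≠ 0 := by omega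
  have hinj : Function.Injective (fun v : ℤ × ℤ => (l * v.1, l * v.2)) := by
    intro v w h
    simp only [Prod.mk.injEq] at h
    exact Prod.ext (mul_left_cancel₀ hl0 h.1) (mul_left_cancel₀ hl0 h.2)
  rw [coneCount, coneCount, ← Set.ncard_image_of_injective (conePts m N) hinj]
  congr 1
  ext v
  constructor
  · rintro ⟨h1, h2, h3⟩
    obtain ⟨⟨x, hx⟩, ⟨w, hw⟩⟩ := hdiv v.1 v.2 (h3 ▸ ⟨l * N, by ring⟩)
    refine ⟨(x, w), ⟨?_, ?_, ?_⟩, Prod.ext hx.symm hw.symm⟩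
    · rw [hx, hw] at h1; simp only; nlinarith
    · rw [hx, hw] at h2; simp only; nlinarith
    · apply mul_left_cancel₀ (pow_ne_zero 2 hl0)
      rw [← h3, hx, hw]; ring
  · rintro ⟨w, ⟨h1, h2, h3⟩, rfl⟩
    refine ⟨?_, ?_, ?_⟩
    · simp only; nlinarith
    · simp only; nlinarith
    · simp only; rw [← h3]; ring

theorem coneCount_inert_pow_mul (N : ℤ) (j : ℕ) :
    coneCount m ((l ^ 2) ^ j * N) = coneCount m N := by
  induction j with
  | zero => simp
  | succ j ih => rw [pow_succ', mul_assoc, coneCount_inert_mul hl hdiv, ih]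

end InertPrime

/-- The reflection `w ↦ -w` preserves the open cone and fixes only `w = 0`. The boundary ray `w = x`
has to be excluded because its reflection is not in the cone. -/
theorem even_coneCount {m N : ℤ} (hm : 2 ≤ m)
    (h : ∀ v ∈ conePts m N, v.2 ≠ 0 ∧ v.2 ≠ v.1) : Even (coneCount m N) := by
  have hfin := conePts_finite (N := N) hm
  have hun : conePts m N = {v ∈ conePts m N | 0 < v.2} ∪ {v ∈ conePts m N | v.2 < 0} := by
    ext v
    constructor
    · intro hv
      rcases lt_or_gt_of_ne (h v hv).1 with h1 | h1
      · exact Or.inr ⟨hv, h1⟩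
      · exact Or.inl ⟨hv, h1⟩
    · rintro (hv | hv) <;> exact hv.1
  have hdis : Disjoint {v ∈ conePts m N | 0 < v.2} {v ∈ conePts m N | v.2 < 0} := by
    rw [Set.disjoint_left]
    rintro v ⟨-, h1⟩ ⟨-, h2⟩
    exact absurd h1 h2.not_gt
  have hcard : {v ∈ conePts m N | 0 < v.2}.ncard = {v ∈ conePts m N | v.2 < 0}.ncard := by
    refine Set.ncard_congr (fun v _ => (v.1, -v.2)) ?_ ?_ ?_
    · rintro v ⟨hv, h1⟩
      have h2 := (h v hv).2
      obtain ⟨a, b, c⟩ := hv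
      refine ⟨⟨?_, ?_, ?_⟩, ?_⟩
      · have := lt_of_le_of_ne b h2; simp only; linarith
      · simp only; linarith
      · simp only; rw [neg_sq]; exact c
      · simp only; linarith
    · rintro v w - - h1
      simp only [Prod.mk.injEq, neg_inj] at h1
      exact Prod.ext h1.1 h1.2
    · rintro v ⟨⟨a, b, c⟩, h1⟩
      refine ⟨(v.1, -v.2), ⟨⟨?_, ?_, ?_⟩, ?_⟩, by simp⟩
      · simp only; linarith
      · simp only; linarith
      · simp only; rw [neg_sq]; exact c
      · simp only; linarith
  rw [coneCount, hun, Set.ncard_union_eq hdis (hfin.subset fun _ hv => hv.1)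
    (hfin.subset fun _ hv => hv.1), hcard]
  exact Even.add_self _

/-! ### The primes 17 and 3 for `√2`, 13 and 5 for `√3` -/

theorem coneCount_two_mul_pow {N : ℤ} (hN : 0 < N) (h17 : ¬ (17 : ℤ) ∣ N) (k : ℕ) :
    coneCount 2 (17 ^ k * N) = (k + 1) * coneCount 2 N := by
  -- The unit is `3 + 2√2`, and `17 = 5² - 2·2²`.
  refine coneCount_mul_pow (m := 2) (u := 2) (g := 5) (h := 2) (p := 17) (by norm_num) (by norm_num)
    (by norm_num) (by norm_num) (by norm_num) (by norm_num) ?_ ?_ hN h17 k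
  · intro x w hd
    -- The product is `25 x² - 4 w² = 4 (2 x² - w²) + 17 x²`.
    have h1 : (17 : ℤ) ∣ (5 * x + 2 * w) * (5 * x + -2 * w) := by
      obtain ⟨c, hc⟩ := hd
      exact ⟨4 * c + x ^ 2, by linear_combination 4 * hc⟩
    rcases (Int.prime_iff_natAbs_prime.2 (by norm_num) : Prime (17 : ℤ)).dvd_or_dvd h1 with h2 | h2
    · left; omega
    · right; omega
  · intro x w
    omega

theorem coneCount_three_mul_pow {N : ℤ} (hN : 0 < N) (h13 : ¬ (13 : ℤ) ∣ N) (k : ℕ) :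
    coneCount 3 (13 ^ k * N) = (k + 1) * coneCount 3 N := by
  -- The unit is `2 + √3`, and `13 = 4² - 3·1²`.
  refine coneCount_mul_pow (m := 3) (u := 1) (g := 4) (h := 1) (p := 13) (by norm_num) (by norm_num)
    (by norm_num) (by norm_num) (by norm_num) (by norm_num) ?_ ?_ hN h13 k
  · intro x w hd
    have h1 : (13 : ℤ) ∣ (4 * x + 1 * w) * (4 * x + -1 * w) := by
      obtain ⟨c, hc⟩ := hd
      exact ⟨c + x ^ 2, by linear_combination hc⟩
    rcases (Int.prime_iff_natAbs_prime.2 (by norm_num) : Prime (13 : ℤ)).dvd_or_dvd h1 with h2 | h2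
    · left; omega
    · right; omega
  · intro x w
    omega

/-- 2 is not a square modulo 3. -/
theorem three_inert (x w : ℤ) (h : (3 : ℤ) ∣ 2 * x ^ 2 - w ^ 2) : (3 : ℤ) ∣ x ∧ (3 : ℤ) ∣ w := by
  have h' : (2 * x ^ 2 - w ^ 2) % 3 = 0 := Int.emod_eq_zero_of_dvd h
  have hx : x % 3 = 0 ∨ x % 3 = 1 ∨ x % 3 = 2 := by omega
  have hw : w % 3 = 0 ∨ w % 3 = 1 ∨ w % 3 = 2 := by omega
  rcases hx with hx | hx | hx <;> rcases hw with hw | hw | hw <;>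
    simp [Int.sub_emod, Int.mul_emod, pow_two, hx, hw] at h' <;> omega

/-- 3 is not a square modulo 5. -/
theorem five_inert (x w : ℤ) (h : (5 : ℤ) ∣ 3 * x ^ 2 - w ^ 2) : (5 : ℤ) ∣ x ∧ (5 : ℤ) ∣ w := by
  have h' : (3 * x ^ 2 - w ^ 2) % 5 = 0 := Int.emod_eq_zero_of_dvd h
  have hx : x % 5 = 0 ∨ x % 5 = 1 ∨ x % 5 = 2 ∨ x % 5 = 3 ∨ x % 5 = 4 := by omega
  have hw : w % 5 = 0 ∨ w % 5 = 1 ∨ w % 5 = 2 ∨ w % 5 = 3 ∨ w % 5 = 4 := by omega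
  rcases hx with hx | hx | hx | hx | hx <;> rcases hw with hw | hw | hw | hw | hw <;>
    simp [Int.sub_emod, Int.mul_emod, pow_two, hx, hw] at h' <;> omega

theorem coneCount_two_family (k j : ℕ) {N : ℤ} (hN : 0 < N) (h17 : ¬ (17 : ℤ) ∣ N) :
    coneCount 2 (9 ^ j * (17 ^ k * N)) = (k + 1) * coneCount 2 N := by
  have := coneCount_inert_pow_mul (m := 2) (l := 3) (by norm_num) three_inert (17 ^ k * N) j
  norm_num at this
  rw [this, coneCount_two_mul_pow hN h17]

theorem coneCount_three_family (k j : ℕ) {N : ℤ} (hN : 0 < N) (h13 : ¬ (13 : ℤ) ∣ N) :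
    coneCount 3 (25 ^ j * (13 ^ k * N)) = (k + 1) * coneCount 3 N := by
  have := coneCount_inert_pow_mul (m := 3) (l := 5) (by norm_num) five_inert (13 ^ k * N) j
  norm_num at this
  rw [this, coneCount_three_mul_pow hN h13]

/-! ### Counts at the starting levels -/

theorem coneCount_eq_one {m N x w : ℤ} (h : conePts m N = {(x, w)}) : coneCount m N = 1 := by
  rw [coneCount, h, Set.ncard_singleton]

theorem mem_conePts {m N x w : ℤ} :
    (x, w) ∈ conePts m N ↔ -x < w ∧ w ≤ x ∧ m * x ^ 2 - w ^ 2 = N := Iff.rfl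

/-- This bound leaves only a few values of `x` to inspect at each starting level. -/
theorem sq_le_of_mem_conePts {m N : ℤ} {v : ℤ × ℤ} (hv : v ∈ conePts m N) :
    (m - 1) * v.1 ^ 2 ≤ N := by
  obtain ⟨h1, h2, h3⟩ := hv
  nlinarith

theorem coneCount_two_one : coneCount 2 1 = 1 := by
  refine coneCount_eq_one (x := 1) (w := 1) ?_
  ext ⟨x, w⟩
  rw [Set.mem_singleton_iff, Prod.mk.injEq]
  constructor
  · intro h
    have hb := sq_le_of_mem_conePts h
    obtain ⟨h1, h2, h3⟩ := mem_conePts.1 h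
    have hx1 : x ≤ 1 := by nlinarith
    have hx0 : 0 < x := by linarith
    interval_cases x
    interval_cases w <;> omega
  · rintro ⟨rfl, rfl⟩
    rw [mem_conePts]; norm_num

theorem coneCount_two_two : coneCount 2 2 = 1 := by
  refine coneCount_eq_one (x := 1) (w := 0) ?_
  ext ⟨x, w⟩
  rw [Set.mem_singleton_iff, Prod.mk.injEq]
  constructor
  · intro h
    have hb := sq_le_of_mem_conePts h
    obtain ⟨h1, h2, h3⟩ := mem_conePts.1 h
    have hx1 : x ≤ 1 := by nlinarith
    have hx0 : 0 < x := by linarith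
    interval_cases x
    interval_cases w <;> omega
  · rintro ⟨rfl, rfl⟩
    rw [mem_conePts]; norm_num

theorem coneCount_three_two : coneCount 3 2 = 1 := by
  refine coneCount_eq_one (x := 1) (w := 1) ?_
  ext ⟨x, w⟩
  rw [Set.mem_singleton_iff, Prod.mk.injEq]
  constructor
  · intro h
    have hb := sq_le_of_mem_conePts h
    obtain ⟨h1, h2, h3⟩ := mem_conePts.1 h
    have hx1 : x ≤ 1 := by nlinarith
    have hx0 : 0 < x := by linarith
    interval_cases x
    interval_cases w <;> omega
  · rintro ⟨rfl, rfl⟩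
    rw [mem_conePts]; norm_num

theorem coneCount_three_three : coneCount 3 3 = 1 := by
  refine coneCount_eq_one (x := 1) (w := 0) ?_
  ext ⟨x, w⟩
  rw [Set.mem_singleton_iff, Prod.mk.injEq]
  constructor
  · intro h
    have hb := sq_le_of_mem_conePts h
    obtain ⟨h1, h2, h3⟩ := mem_conePts.1 h
    have hx1 : x ≤ 1 := by nlinarith
    have hx0 : 0 < x := by linarith
    interval_cases x
    interval_cases w <;> omega
  · rintro ⟨rfl, rfl⟩
    rw [mem_conePts]; norm_num

theorem coneCount_three_twelve : coneCount 3 12 = 1 := by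
  refine coneCount_eq_one (x := 2) (w := 0) ?_
  ext ⟨x, w⟩
  rw [Set.mem_singleton_iff, Prod.mk.injEq]
  constructor
  · intro h
    have hb := sq_le_of_mem_conePts h
    obtain ⟨h1, h2, h3⟩ := mem_conePts.1 h
    have hx1 : x ≤ 2 := by nlinarith
    have hx0 : 0 < x := by linarith
    interval_cases x <;> interval_cases w <;> omega
  · rintro ⟨rfl, rfl⟩
    rw [mem_conePts]; norm_num

theorem coneCount_two_fourteen : coneCount 2 14 = 2 := by
  have h : conePts 2 14 = {((3 : ℤ), (2 : ℤ)), (3, -2)} := by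
    ext ⟨x, w⟩
    rw [Set.mem_insert_iff, Set.mem_singleton_iff, Prod.mk.injEq, Prod.mk.injEq]
    constructor
    · intro h
      have hb := sq_le_of_mem_conePts h
      obtain ⟨h1, h2, h3⟩ := mem_conePts.1 h
      have hx1 : x ≤ 3 := by nlinarith
      have hx0 : 0 < x := by linarith
      interval_cases x <;> interval_cases w <;> omega
    · rintro (⟨rfl, rfl⟩ | ⟨rfl, rfl⟩) <;> rw [mem_conePts] <;> norm_num
  rw [coneCount, h, Set.ncard_pair (by decide)]

theorem coneCount_three_sixtySix : coneCount 3 66 = 2 := by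
  have h : conePts 3 66 = {((5 : ℤ), (3 : ℤ)), (5, -3)} := by
    ext ⟨x, w⟩
    rw [Set.mem_insert_iff, Set.mem_singleton_iff, Prod.mk.injEq, Prod.mk.injEq]
    constructor
    · intro h
      have hb := sq_le_of_mem_conePts h
      obtain ⟨h1, h2, h3⟩ := mem_conePts.1 h
      have hx1 : x ≤ 5 := by nlinarith
      have hx0 : 0 < x := by linarith
      interval_cases x <;> interval_cases w <;> omega
    · rintro (⟨rfl, rfl⟩ | ⟨rfl, rfl⟩) <;> rw [mem_conePts] <;> norm_num
  rw [coneCount, h, Set.ncard_pair (by decide)]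

/-! ### Bailey pairs over a field -/

section Telescoping

variable {K : Type*} [Field K]

/-- The shift matters: in the applications `a r` and `b r` both contain `E r`, and the first-order
recurrence of `E` cancels it from `a (r + 1) - b r`. What remains is the difference of the explicit
`L`. -/
theorem sum_sub_of_shift (a b L : ℕ → K) (h0 : a 0 = -L 0)
    (hs : ∀ r, a (r + 1) - b r = L r - L (r + 1)) (R : ℕ) :
    ∑ r ∈ Finset.range (R + 1), (a r - b r) = -b R - L R := by
  induction R with
  | zero => rw [Finset.sum_range_one, h0]; ring
  | succ R ih => rw [Finset.sum_range_succ, ih]; linear_combination hs R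

/-- The analogue for a recurrence linking `E (r + 2)` to `E r`, which leaves two boundary terms at
each end. -/
theorem sum_sub_of_shift_two (a b L : ℕ → K) (h0 : a 0 + a 1 = -L 1)
    (hs : ∀ r, a (r + 2) - b r = L (r + 1) - L (r + 2)) (R : ℕ) :
    ∑ r ∈ Finset.range (R + 2), (a r - b r) = -b R - b (R + 1) - L (R + 1) := by
  induction R with
  | zero => rw [Finset.sum_range_succ, Finset.sum_range_one]; linear_combination h0
  | succ R ih => rw [Finset.sum_range_succ, ih]; linear_combination hs R

/-- With `K₁` and `K₀` the kernels at `n + 1` and `n`, this turns a telescoping identity in `r` into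
a first-order recurrence in `n` for `β_n`. As `K₀` vanishes at `n + 1`, both sums may run over the
same range. -/
theorem recurrence_of_telescope {W K₁ K₀ a b : ℕ → K} {x y : K} {n : ℕ}
    (hK₀ : K₀ (n + 1) = 0) (hW : ∀ r, W r * (x * K₁ r - y * K₀ r) = a r - b r)
    (hsum : ∑ r ∈ Finset.range (n + 2), (a r - b r) = 0) :
    x * ∑ r ∈ Finset.range (n + 2), W r * K₁ r = y * ∑ r ∈ Finset.range (n + 1), W r * K₀ r := by
  have hlast : ∑ r ∈ Finset.range (n + 1), W r * K₀ r = ∑ r ∈ Finset.range (n + 2), W r * K₀ r := by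
    rw [Finset.sum_range_succ _ (n + 1), hK₀, mul_zero, add_zero]
  rw [hlast, ← sub_eq_zero, ← hsum, Finset.mul_sum, Finset.mul_sum, ← Finset.sum_sub_distrib]
  refine Finset.sum_congr rfl fun r _ => ?_
  rw [← hW]
  ring

/-- The reciprocal of `(p; p)_s`. -/
def invPoch (p : K) (s : ℕ) : K := (∏ j ∈ Finset.range s, (1 - p ^ (j + 1)))⁻¹

/-- The reciprocal of `(p; p)_{n-r}`, zero if `n < r`. -/
def invPochSub (p : K) (n r : ℕ) : K := if r ≤ n then invPoch p (n - r) else 0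

theorem invPoch_zero (p : K) : invPoch p 0 = 1 := by simp [invPoch]

theorem invPochSub_zero (p : K) (n : ℕ) : invPochSub p n 0 = invPoch p n := by simp [invPochSub]

theorem invPochSub_self (p : K) (n : ℕ) : invPochSub p n n = 1 := by
  simp [invPochSub, invPoch_zero]

theorem invPochSub_of_lt (p : K) {n r : ℕ} (h : n < r) : invPochSub p n r = 0 := by
  simp [invPochSub, not_le.2 h]

theorem invPochSub_succ_succ (p : K) (n r : ℕ) :
    invPochSub p (n + 1) (r + 1) = invPochSub p n r := by
  simp [invPochSub]

variable {p : K} (hp : ∀ k, p ^ (k + 1) ≠ 1)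

include hp

theorem one_sub_pow_succ_ne (k : ℕ) : 1 - p ^ (k + 1) ≠ 0 := sub_ne_zero.2 (hp k).symm

theorem invPoch_succ (s : ℕ) : invPoch p s = (1 - p ^ (s + 1)) * invPoch p (s + 1) := by
  have h := one_sub_pow_succ_ne hp s
  rw [invPoch, invPoch, Finset.prod_range_succ, mul_inv]
  field_simp

/-- No condition `r ≤ n` is needed: the factor vanishes at `r = n`, and beyond that both sides are
zero. -/
theorem invPochSub_succ (hp0 : p ≠ 0) (n r : ℕ) :
    invPochSub p n (r + 1) = (1 - p ^ n / p ^ r) * invPochSub p n r := by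
  rcases lt_trichotomy n r with h | rfl | h
  · rw [invPochSub_of_lt p h, invPochSub_of_lt p (h.trans r.lt_succ_self), mul_zero]
  · rw [invPochSub_of_lt p n.lt_succ_self, div_self (pow_ne_zero _ hp0), sub_self, zero_mul]
  · obtain ⟨s, rfl⟩ := Nat.exists_eq_add_of_lt h
    rw [invPochSub, invPochSub, if_pos (by omega), if_pos (by omega),
      show r + s + 1 - (r + 1) = s by omega, show r + s + 1 - r = s + 1 by omega, invPoch_succ hp s,
      show p ^ (r + s + 1) / p ^ r = p ^ (s + 1) by rw [add_assoc, pow_add]; field_simp]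

theorem invPochSub_pred (hp0 : p ≠ 0) (n r : ℕ) :
    invPochSub p n r = (1 - p ^ (n + 1) / p ^ r) * invPochSub p (n + 1) r := by
  rw [← invPochSub_succ hp hp0, invPochSub_succ_succ]

end Telescoping

section BaileyPairs

variable {K : Type*} [Field K] {q : K} (hq0 : q ≠ 0) (hq : ∀ k, q ^ (k + 1) ≠ 1)

include hq in
theorem sq_pow_succ_ne_one (k : ℕ) : (q ^ 2) ^ (k + 1) ≠ 1 := by
  rw [← pow_mul]
  exact hq (2 * k + 1)

theorem triangle_succ (r : ℕ) : (r + 1) * (r + 1 + 1) / 2 = r * (r + 1) / 2 + (r + 1) := by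
  rw [show (r + 1) * (r + 1 + 1) = r * (r + 1) + (r + 1) * 2 by ring]
  omega

include hq0 hq

/-- The Bailey pair with `β_n = 1 / (q; q²)_{n+1}`. -/
theorem bailey_odd (E : ℕ → K) (hE0 : E 0 = 1)
    (hE : ∀ r, E (r + 1) = q ^ (2 * r + 2) * E r + q ^ ((r + 1) * (r + 2) / 2) * (1 + q ^ (r + 1)))
    (n : ℕ) :
    (∏ j ∈ Finset.range (n + 1), (1 - q ^ (2 * j + 1))) * ∑ r ∈ Finset.range (n + 1),
      (-1) ^ r * E r * (invPochSub q n r * invPoch q (n + r + 1)) = 1 := by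
  induction n with
  | zero =>
    have h1 := one_sub_pow_succ_ne hq 0
    simp only [zero_add, Finset.prod_range_one, Finset.sum_range_one, hE0, invPochSub_self]
    simp [invPoch] at h1 ⊢
    field_simp
  | succ n ih =>
    rw [Finset.prod_range_succ, mul_assoc]
    refine Eq.trans (congrArg _ ?_) ih
    rw [← one_mul (∑ r ∈ Finset.range (n + 1), _)]
    have hN := one_sub_pow_succ_ne hq n
    -- The claim is `(1 - q^(2n+3)) β_{n+1} = β_n`. In `a (r + 1) - b r` the multiples of `E r`
    -- cancel, and the theta terms left over telescope.
    refine recurrence_of_telescope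
      (a := fun r => (-1) ^ r * E r * (q ^ (n + 1) / q ^ r) *
        (invPochSub q (n + 1) r * invPoch q (n + 1 + r)))
      (b := fun r => - ((-1) ^ r * E r * (q ^ (n + 1) * q ^ (r + 1)) *
        (invPochSub q (n + 1) (r + 1) * invPoch q (n + 1 + r + 1)))) ?_ ?_
      ((sum_sub_of_shift _ _ (fun r => - ((-1) ^ r * q ^ (n + 1) / (1 - q ^ (n + 1)) *
        q ^ (r * (r + 1) / 2) * (invPochSub q (n + 1) (r + 1) * invPoch q (n + 1 + r))))
        ?_ ?_ (n + 1)).trans ?_)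
    · rw [invPochSub_of_lt q n.lt_succ_self, zero_mul]
    · intro r
      rw [invPochSub_succ hq hq0, invPochSub_pred hq hq0 n r,
        show n + r + 1 = n + 1 + r by ring, invPoch_succ hq (n + 1 + r)]
      have := pow_ne_zero r hq0
      field_simp
      ring
    · simp only [hE0, invPochSub_zero, pow_zero, add_zero, invPochSub_succ hq hq0]
      field_simp
      ring
    · intro r
      simp only [hE]
      rw [invPochSub_succ hq hq0 _ (r + 1), invPochSub_succ hq hq0 _ r,
        show n + 1 + (r + 1) = n + 1 + r + 1 by ring, invPoch_succ hq (n + 1 + r), triangle_succ]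
      have := pow_ne_zero r hq0
      field_simp
      ring
    · simp only [invPochSub_of_lt q (Nat.lt_succ_self (n + 1))]
      ring

/-- The Bailey pair with `β_n = 1 / (-q)_{2n+1}`. -/
theorem bailey_neg_odd (E : ℕ → K) (hE0 : E 0 = 1)
    (hE : ∀ r, E (r + 1) = q ^ (4 * r + 3) * E r + 2 * (-1) ^ (r + 1) * q ^ ((r + 1) * (r + 2)))
    (n : ℕ) :
    (∏ j ∈ Finset.range (2 * n + 1), (1 + q ^ (j + 1))) * ∑ r ∈ Finset.range (n + 1),
      E r * (1 - q ^ (2 * r + 1)) * (invPochSub (q ^ 2) n r * invPoch (q ^ 2) (n + r + 1)) = 1 := by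
  have hp := sq_pow_succ_ne_one hq
  have hp0 := pow_ne_zero 2 hq0
  induction n with
  | zero =>
    have h1 := one_sub_pow_succ_ne hp 0
    simp [hE0, invPochSub_self, invPoch] at h1 ⊢
    field_simp
    ring
  | succ n ih =>
    rw [show 2 * (n + 1) + 1 = 2 * n + 1 + 1 + 1 by ring, Finset.prod_range_succ,
      Finset.prod_range_succ, mul_assoc, mul_assoc]
    refine Eq.trans (congrArg _ ?_) ih
    rw [← one_mul (∑ r ∈ Finset.range (n + 1), _), ← mul_assoc]
    have hN := one_sub_pow_succ_ne hp n
    refine recurrence_of_telescope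
      (a := fun r => E r * (q ^ (2 * n + 2) / q ^ (2 * r)) * (1 + q ^ (2 * r)) *
        (invPochSub (q ^ 2) (n + 1) r * invPoch (q ^ 2) (n + 1 + r)))
      (b := fun r => E r * (q ^ (2 * n + 2) * q ^ (2 * r + 1)) * (1 + q ^ (2 * r + 2)) *
        (invPochSub (q ^ 2) (n + 1) (r + 1) * invPoch (q ^ 2) (n + 1 + r + 1))) ?_ ?_
      ((sum_sub_of_shift _ _ (fun r => - (2 * (-1) ^ r * q ^ (2 * n + 2) / (1 - (q ^ 2) ^ (n + 1)) *
        q ^ (r * (r + 1)) * (invPochSub (q ^ 2) (n + 1) (r + 1) * invPoch (q ^ 2) (n + 1 + r))))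
        ?_ ?_ (n + 1)).trans ?_)
    · rw [invPochSub_of_lt _ n.lt_succ_self, zero_mul]
    · intro r
      rw [invPochSub_succ hp hp0, invPochSub_pred hp hp0 n r,
        show n + r + 1 = n + 1 + r by ring, invPoch_succ hp (n + 1 + r)]
      have := pow_ne_zero r hq0
      field_simp
      ring
    · simp only [hE0, invPochSub_zero, pow_zero, add_zero, invPochSub_succ hp hp0]
      field_simp
      ring
    · intro r
      simp only [hE]
      rw [invPochSub_succ hp hp0 _ (r + 1), invPochSub_succ hp hp0 _ r,
        show n + 1 + (r + 1) = n + 1 + r + 1 by ring, invPoch_succ hp (n + 1 + r)]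
      have := pow_ne_zero r hq0
      field_simp
      ring
    · simp only [invPochSub_of_lt _ (Nat.lt_succ_self (n + 1))]
      ring

/-- The Bailey pair with `β_n = (-1)^n / ((q⁴; q⁴)_n (1 - q^{2n+1}))`. -/
theorem bailey_alternating (E : ℕ → K) (hE0 : E 0 = 1)
    (hE : ∀ r, E (r + 1) = q ^ (2 * r + 1) * E r + 2) (n : ℕ) :
    (∏ j ∈ Finset.range n, (1 - q ^ (4 * (j + 1)))) * ((1 - q ^ (2 * n + 1)) *
      ∑ r ∈ Finset.range (n + 1), (-1) ^ r * E r * (1 + q ^ (2 * r + 1)) *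
        (invPochSub (q ^ 2) n r * invPoch (q ^ 2) (n + r + 1))) = (-1) ^ n := by
  have hp := sq_pow_succ_ne_one hq
  have hp0 := pow_ne_zero 2 hq0
  induction n with
  | zero =>
    have h1 := one_sub_pow_succ_ne hp 0
    simp [hE0, invPochSub_self, invPoch] at h1 ⊢
    field_simp
    ring
  | succ n ih =>
    rw [Finset.prod_range_succ, mul_assoc, pow_succ (-1 : K) n, ← ih, mul_assoc _ _ (-1 : K)]
    congr 1
    rw [← mul_assoc, mul_comm _ (-1 : K), ← mul_assoc]
    have hN := one_sub_pow_succ_ne hp n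
    -- The recurrence of `E` has the constant inhomogeneity 2, so the telescoping term carries no
    -- theta power of `q`.
    refine recurrence_of_telescope
      (a := fun r => (-1) ^ r * E r * (2 - q ^ (2 * n + 2) / q ^ (2 * r) - q ^ (2 * n + 2) * q ^ (2 * r)) *
        (invPochSub (q ^ 2) (n + 1) r * invPoch (q ^ 2) (n + 1 + r)))
      (b := fun r => - ((-1) ^ r * E r * q ^ (2 * r + 1) *
        (2 - q ^ (2 * n + 2) / q ^ (2 * r + 2) - q ^ (2 * n + 2) * q ^ (2 * r + 2)) *
        (invPochSub (q ^ 2) (n + 1) (r + 1) * invPoch (q ^ 2) (n + 1 + r + 1)))) ?_ ?_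
      ((sum_sub_of_shift _ _ (fun r => - (2 * (-1) ^ r *
        (invPochSub (q ^ 2) (n + 1) (r + 1) * invPoch (q ^ 2) (n + 1 + r))))
        ?_ ?_ (n + 1)).trans ?_)
    · rw [invPochSub_of_lt _ n.lt_succ_self, zero_mul]
    · intro r
      rw [invPochSub_succ hp hp0, invPochSub_pred hp hp0 n r,
        show n + r + 1 = n + 1 + r by ring, invPoch_succ hp (n + 1 + r)]
      have := pow_ne_zero r hq0
      field_simp
      ring
    · simp only [hE0, invPochSub_zero, pow_zero, add_zero, invPochSub_succ hp hp0]
      field_simp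
      ring
    · intro r
      simp only [hE]
      rw [invPochSub_succ hp hp0 _ (r + 1), invPochSub_succ hp hp0 _ r,
        show n + 1 + (r + 1) = n + 1 + r + 1 by ring, invPoch_succ hp (n + 1 + r)]
      have := pow_ne_zero r hq0
      field_simp
      ring
    · simp only [invPochSub_of_lt _ (Nat.lt_succ_self (n + 1))]
      ring

/-- The Bailey pair with `β_n = 1 / (-q)_{2n+2}`. -/
theorem bailey_neg_even (E : ℕ → K) (hE0 : E 0 = 1 - q)
    (hE : ∀ r, E (r + 1) = q ^ (4 * r + 5) * E r +
      (-1) ^ (r + 1) * q ^ ((r + 1) * (r + 2)) * (1 - q ^ (2 * r + 3)))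
    (n : ℕ) :
    (∏ j ∈ Finset.range (2 * n + 2), (1 + q ^ (j + 1))) * ∑ r ∈ Finset.range (n + 1),
      E r * (1 - q ^ (2 * r + 2)) * (invPochSub (q ^ 2) n r * invPoch (q ^ 2) (n + r + 2)) = 1 := by
  have hp := sq_pow_succ_ne_one hq
  have hp0 := pow_ne_zero 2 hq0
  induction n with
  | zero =>
    have h1 := one_sub_pow_succ_ne hp 0
    have h2 := one_sub_pow_succ_ne hq 3
    simp [hE0, invPochSub_self, invPoch, Finset.prod_range_succ, ← pow_mul] at h1 h2 ⊢
    field_simp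
    ring
  | succ n ih =>
    rw [show 2 * (n + 1) + 2 = 2 * n + 2 + 1 + 1 by ring, Finset.prod_range_succ,
      Finset.prod_range_succ, mul_assoc, mul_assoc]
    refine Eq.trans (congrArg _ ?_) ih
    rw [← one_mul (∑ r ∈ Finset.range (n + 1), _), ← mul_assoc]
    have hN := one_sub_pow_succ_ne hp n
    refine recurrence_of_telescope
      (a := fun r => E r * (q ^ (2 * n + 2) / q ^ (2 * r)) * (1 + q ^ (2 * r + 1)) *
        (invPochSub (q ^ 2) (n + 1) r * invPoch (q ^ 2) (n + 1 + r + 1)))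
      (b := fun r => E r * (q ^ (2 * n + 2) * q ^ (2 * r + 3)) * (1 + q ^ (2 * r + 3)) *
        (invPochSub (q ^ 2) (n + 1) (r + 1) * invPoch (q ^ 2) (n + 1 + r + 1 + 1))) ?_ ?_
      ((sum_sub_of_shift _ _ (fun r => - ((-1) ^ r * q ^ (2 * n + 2) / (1 - (q ^ 2) ^ (n + 1)) *
        q ^ (r * (r + 1)) * (1 - q ^ (2 * r + 2)) *
        (invPochSub (q ^ 2) (n + 1) (r + 1) * invPoch (q ^ 2) (n + 1 + r + 1))))
        ?_ ?_ (n + 1)).trans ?_)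
    · rw [invPochSub_of_lt _ n.lt_succ_self, zero_mul]
    · intro r
      rw [invPochSub_succ hp hp0, invPochSub_pred hp hp0 n r,
        show n + 1 + r + 2 = n + 1 + r + 1 + 1 by ring,
        show n + r + 2 = n + 1 + r + 1 by ring, invPoch_succ hp (n + 1 + r + 1)]
      have := pow_ne_zero r hq0
      field_simp
      ring
    · simp only [hE0, invPochSub_zero, pow_zero, add_zero, invPochSub_succ hp hp0]
      field_simp
      ring
    · intro r
      simp only [hE]
      rw [invPochSub_succ hp hp0 _ (r + 1), invPochSub_succ hp hp0 _ r,
        show n + 1 + (r + 1) = n + 1 + r + 1 by ring, invPoch_succ hp (n + 1 + r + 1)]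
      have := pow_ne_zero r hq0
      field_simp
      ring
    · simp only [invPochSub_of_lt _ (Nat.lt_succ_self (n + 1))]
      ring

/-- The Bailey pair with `β_n = 1 / ((q; q²)_{n+1} (-q)_n)`. -/
theorem bailey_mixed (E : ℕ → K) (hE0 : E 0 = 1) (hE1 : E 1 = 2 * q)
    (hE : ∀ r, E (r + 2) = q ^ (3 * r + 4) * E r + 2 * q ^ ((r + 2) * (r + 3) / 2)) (n : ℕ) :
    ((∏ j ∈ Finset.range (n + 1), (1 - q ^ (2 * j + 1))) * ∏ j ∈ Finset.range n, (1 + q ^ (j + 1))) *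
      ∑ r ∈ Finset.range (n + 1),
      (-1) ^ r * E r * (1 - q ^ (2 * r + 2)) * (invPochSub q n r * invPoch q (n + r + 2)) = 1 := by
  induction n with
  | zero =>
    have h1 := one_sub_pow_succ_ne hq 0
    have h2 := one_sub_pow_succ_ne hq 1
    simp [hE0, invPochSub_self, invPoch, Finset.prod_range_succ] at h1 h2 ⊢
    field_simp
  | succ n ih =>
    rw [Finset.prod_range_succ _ (n + 1), Finset.prod_range_succ (fun j => 1 + q ^ (j + 1)) n, mul_mul_mul_comm, mul_assoc]
    refine Eq.trans (congrArg _ ?_) ih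
    rw [← one_mul (∑ r ∈ Finset.range (n + 1), _)]
    have hN := one_sub_pow_succ_ne hq n
    -- The factor `1 - q^(2r+2)` is absorbed by splitting into kernels at `r` and `r + 2`, matching
    -- the two-step recurrence of `E`.
    refine recurrence_of_telescope
      (a := fun r => (-1) ^ r * E r * (q ^ (n + 1) / q ^ r) * (1 + q ^ r) *
        (invPochSub q (n + 1) r * invPoch q (n + 1 + r)))
      (b := fun r => (-1) ^ r * E r * (q ^ (n + 1) * q ^ (2 * r + 2)) * (1 + q ^ (r + 2)) *
        (invPochSub q (n + 1) (r + 2) * invPoch q (n + 1 + r + 2))) ?_ ?_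
      ((sum_sub_of_shift_two _ _ (fun r => - (2 * (-1) ^ r * q ^ (n + 1) / (1 - q ^ (n + 1)) *
        q ^ (r * (r + 1) / 2) * (invPochSub q (n + 1) (r + 1) * invPoch q (n + 1 + r))))
        ?_ ?_ n).trans ?_)
    · rw [invPochSub_of_lt q n.lt_succ_self, zero_mul]
    · intro r
      rw [invPochSub_succ hq hq0 _ (r + 1), invPochSub_succ hq hq0, invPochSub_pred hq hq0 n r,
        show n + r + 2 = n + 1 + r + 1 by ring, invPoch_succ hq (n + 1 + r),
        invPoch_succ hq (n + 1 + r + 1)]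
      have := pow_ne_zero r hq0
      field_simp
      ring
    · simp only [hE0, hE1, invPochSub_zero, pow_zero, pow_one, add_zero,
        invPochSub_succ hq hq0, invPoch_succ hq (n + 1)]
      norm_num
      field_simp
      ring
    · intro r
      simp only [hE]
      rw [invPochSub_succ hq hq0 _ (r + 2), invPochSub_succ hq hq0 _ (r + 1),
        show n + 1 + (r + 2) = n + 1 + r + 1 + 1 by ring, show n + 1 + (r + 1) = n + 1 + r + 1 by ring,
        invPoch_succ hq (n + 1 + r + 1),
        show (r + 2) * (r + 2 + 1) / 2 = (r + 1) * (r + 1 + 1) / 2 + (r + 2) from triangle_succ (r + 1)]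
      have := pow_ne_zero r hq0
      field_simp
      ring
    · rw [invPochSub_of_lt _ (show n + 1 < n + 2 by omega),
        invPochSub_of_lt _ (show n + 1 < n + 1 + 2 by omega)]
      ring

end BaileyPairs

/-! ### Conjugate Bailey pairs modulo powers of `q` -/

section Conjugate

variable {K : Type*} [Field K] (O : Subring K) (q : K)

/-- `x` is divisible by `q^D` in the subring `O`. -/
def IsSmall (D : ℕ) (x : K) : Prop := ∃ y ∈ O, x = q ^ D * y

variable {O q}

theorem IsSmall.add {D : ℕ} {x y : K} (hx : IsSmall O q D x) (hy : IsSmall O q D y) :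
    IsSmall O q D (x + y) := by
  obtain ⟨a, ha, rfl⟩ := hx
  obtain ⟨b, hb, rfl⟩ := hy
  exact ⟨a + b, O.add_mem ha hb, by ring⟩

theorem IsSmall.mul {D : ℕ} {x y : K} (hx : IsSmall O q D x) (hy : y ∈ O) :
    IsSmall O q D (x * y) := by
  obtain ⟨a, ha, rfl⟩ := hx
  exact ⟨a * y, O.mul_mem ha hy, by ring⟩

theorem IsSmall.neg {D : ℕ} {x : K} (hx : IsSmall O q D x) : IsSmall O q D (-x) := by
  obtain ⟨a, ha, rfl⟩ := hx
  exact ⟨-a, O.neg_mem ha, by ring⟩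

theorem IsSmall.sub {D : ℕ} {x y : K} (hx : IsSmall O q D x) (hy : IsSmall O q D y) :
    IsSmall O q D (x - y) := by
  rw [sub_eq_add_neg]
  exact hx.add hy.neg

theorem isSmall_zero (D : ℕ) : IsSmall O q D 0 := ⟨0, O.zero_mem, by ring⟩

theorem isSmall_sum {ι : Type*} {D : ℕ} (s : Finset ι) (f : ι → K) (h : ∀ i ∈ s, IsSmall O q D (f i)) :
    IsSmall O q D (∑ i ∈ s, f i) := by
  classical
  induction s using Finset.induction_on with
  | empty => exact isSmall_zero D
  | insert a s ha ih =>
    rw [Finset.sum_insert ha]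
    exact (h a (Finset.mem_insert_self a s)).add (ih fun i hi => h i (Finset.mem_insert_of_mem hi))

/-- Bailey's lemma is an interchange of summations. The kernel vanishes for `n < r`, so the inner
sums extend to a common range, and `γ` is needed only modulo `q^D`. -/
theorem bailey_transform {W δ γ β : ℕ → K} {k : ℕ → ℕ → K} {D : ℕ}
    (hβ : ∀ n, β n = ∑ r ∈ Finset.range (n + 1), W r * k n r) (hk : ∀ n r, n < r → k n r = 0)
    (hγ : ∀ r, IsSmall O q D (∑ n ∈ Finset.range D, δ n * k n r - γ r)) (hW : ∀ r, W r ∈ O) :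
    IsSmall O q D (∑ n ∈ Finset.range D, δ n * β n - ∑ r ∈ Finset.range D, W r * γ r) := by
  have h1 : ∀ n ∈ Finset.range D, δ n * β n = ∑ r ∈ Finset.range D, W r * (δ n * k n r) := by
    intro n hn
    have hle : n + 1 ≤ D := Finset.mem_range.1 hn
    rw [hβ, Finset.mul_sum, ← Finset.sum_subset (Finset.range_mono hle)]
    · exact Finset.sum_congr rfl fun r _ => by ring
    · intro r _ hr
      rw [hk n r (by simpa using hr), mul_zero, mul_zero]
  rw [Finset.sum_congr rfl h1, Finset.sum_comm, ← Finset.sum_sub_distrib]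
  refine isSmall_sum _ _ fun r _ => ?_
  rw [← Finset.mul_sum, ← mul_sub, mul_comm]
  exact (hγ r).mul (hW r)

/-- The truncated sum `Γ` obeys the recurrence of `γ` up to the small error `M`. Since the leading
coefficient is invertible in `O`, smallness of the difference passes from `r` to `r + 1`. -/
theorem isSmall_of_recurrence {D : ℕ} {Γ γ x y M : ℕ → K}
    (hΓ : ∀ r, x r * Γ (r + 1) - y r * Γ r = -M r) (hγ : ∀ r, x r * γ (r + 1) = y r * γ r)
    (hx0 : ∀ r, x r ≠ 0) (hx : ∀ r, (x r)⁻¹ ∈ O) (hy : ∀ r, y r ∈ O)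
    (hM : ∀ r, IsSmall O q D (M r)) (h0 : IsSmall O q D (Γ 0 - γ 0)) (r : ℕ) :
    IsSmall O q D (Γ r - γ r) := by
  induction r with
  | zero => exact h0
  | succ r ih =>
    have : Γ (r + 1) - γ (r + 1) = ((Γ r - γ r) * y r - M r) * (x r)⁻¹ := by
      rw [eq_mul_inv_iff_mul_eq₀ (hx0 r)]
      linear_combination hΓ r - hγ r
    rw [this]
    exact ((ih.mul (hy r)).sub (hM r)).mul (hx r)

variable (hqO : q ∈ O) (hO : ∀ k, (1 - q ^ (k + 1))⁻¹ ∈ O)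

include hO in
theorem invPoch_mem (s : ℕ) : invPoch q s ∈ O := by
  rw [invPoch, ← Finset.prod_inv_distrib]
  exact O.prod_mem fun j _ => hO j

include hO in
theorem invPochSub_mem (n r : ℕ) : invPochSub q n r ∈ O := by
  rw [invPochSub]
  split_ifs
  · exact invPoch_mem hO _
  · exact O.zero_mem

include hO in
theorem inv_one_sub_sq_mem (k : ℕ) : (1 - (q ^ 2) ^ (k + 1))⁻¹ ∈ O := by
  rw [← pow_mul]
  exact hO (2 * k + 1)

/-- A sequence growing by factors divisible by `q` has `n`-th term divisible by `q^n`. -/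
theorem isSmall_of_step {δ c : ℕ → K} (h0 : δ 0 ∈ O) (hc : ∀ n, c n ∈ O)
    (h : ∀ n, δ (n + 1) = q * c n * δ n) (n : ℕ) : IsSmall O q n (δ n) := by
  induction n with
  | zero => exact ⟨δ 0, h0, by ring⟩
  | succ n ih =>
    obtain ⟨y, hy, hn⟩ := ih
    exact ⟨c n * y, O.mul_mem (hc n) hy, by rw [h, hn]; ring⟩

/-! ### Exact recurrences for the truncated conjugate sums -/

section Exact

variable (hq0 : q ≠ 0) (hq : ∀ k, q ^ (k + 1) ≠ 1)

variable {p : K} (hp0 : p ≠ 0) (hp : ∀ k, p ^ (k + 1) ≠ 1) {δ : ℕ → K} (D r : ℕ)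

include hp0 hp in
-- Truncation at `D` leaves a single boundary term proportional to `δ D`, verified by induction on
-- `D`. This proportionality makes the error divisible by `q^D`; the other `_step` and `_zero`
-- lemmas have the same shape.
theorem conj_alternating_step (hδ : ∀ n, δ (n + 1) = -p ^ (n + 1) * (1 - p ^ (n + 1)) * δ n) :
    1 * (∑ n ∈ Finset.range D, δ n * (invPochSub p n (r + 1) * invPoch p (n + (r + 1) + 1))) -
      -p ^ (r + 1) * (∑ n ∈ Finset.range D, δ n * (invPochSub p n r * invPoch p (n + r + 1))) =
      -(δ D * (1 + p ^ (r + 1)) * (invPochSub p D (r + 1) * invPoch p (D + r + 1))) := by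
  induction D with
  | zero => simp [invPochSub_of_lt p r.succ_pos]
  | succ D ih =>
    rw [Finset.sum_range_succ, Finset.sum_range_succ, mul_add, mul_add]
    -- The summand at index `D` is split off so that the induction hypothesis applies to the rest.
    refine (by ring : _ = _ + (1 * (δ D * (invPochSub p D (r + 1) * invPoch p (D + (r + 1) + 1))) -
      -p ^ (r + 1) * (δ D * (invPochSub p D r * invPoch p (D + r + 1))))).trans
      ((congrArg (· + _) ih).trans ?_)
    rw [invPochSub_succ_succ, invPochSub_succ hp hp0, hδ, show D + (r + 1) + 1 = D + r + 1 + 1 by ring,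
      show D + 1 + r + 1 = D + r + 1 + 1 by ring, invPoch_succ hp (D + r + 1)]
    have := pow_ne_zero r hp0
    field_simp
    ring

include hp in
theorem conj_alternating_zero (hδ0 : δ 0 = 1)
    (hδ : ∀ n, δ (n + 1) = -p ^ (n + 1) * (1 - p ^ (n + 1)) * δ n) :
    ∑ n ∈ Finset.range D, δ n * (invPochSub p n 0 * invPoch p (n + 0 + 1)) =
      1 - δ D * (invPoch p D * invPoch p D) := by
  induction D with
  | zero => simp [hδ0, invPoch_zero]
  | succ D ih =>
    rw [Finset.sum_range_succ, ih, invPochSub_zero, hδ, add_zero, invPoch_succ hp D]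
    ring

include hq0 hq in
theorem conj_even_step (hδ : ∀ n, δ (n + 1) = q * (1 - q ^ (2 * n + 1)) * (1 - q ^ (2 * n + 2)) * δ n) :
    (1 - q ^ (2 * r + 3)) * (∑ n ∈ Finset.range D,
        δ n * (invPochSub (q ^ 2) n (r + 1) * invPoch (q ^ 2) (n + (r + 1) + 1))) -
      q * (1 - q ^ (2 * r + 1)) *
        (∑ n ∈ Finset.range D, δ n * (invPochSub (q ^ 2) n r * invPoch (q ^ 2) (n + r + 1))) =
      -(δ D * (1 + q ^ (2 * r + 2)) *
        (invPochSub (q ^ 2) D (r + 1) * invPoch (q ^ 2) (D + r + 1))) := by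
  have hp := sq_pow_succ_ne_one hq
  have hp0 := pow_ne_zero 2 hq0
  induction D with
  | zero => simp [invPochSub_of_lt _ r.succ_pos]
  | succ D ih =>
    rw [Finset.sum_range_succ, Finset.sum_range_succ, mul_add, mul_add]
    refine (by ring : _ = _ + ((1 - q ^ (2 * r + 3)) *
        (δ D * (invPochSub (q ^ 2) D (r + 1) * invPoch (q ^ 2) (D + (r + 1) + 1))) -
      q * (1 - q ^ (2 * r + 1)) * (δ D * (invPochSub (q ^ 2) D r * invPoch (q ^ 2) (D + r + 1))))).trans
      ((congrArg (· + _) ih).trans ?_)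
    rw [invPochSub_succ_succ, invPochSub_succ hp hp0, hδ, show D + (r + 1) + 1 = D + r + 1 + 1 by ring,
      show D + 1 + r + 1 = D + r + 1 + 1 by ring, invPoch_succ hp (D + r + 1)]
    have := pow_ne_zero r hq0
    field_simp
    ring

include hq in
theorem conj_even_zero (hδ0 : δ 0 = 1)
    (hδ : ∀ n, δ (n + 1) = q * (1 - q ^ (2 * n + 1)) * (1 - q ^ (2 * n + 2)) * δ n) :
    ∑ n ∈ Finset.range D, δ n * (invPochSub (q ^ 2) n 0 * invPoch (q ^ 2) (n + 0 + 1)) =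
      (1 - q)⁻¹ - δ D * (invPoch (q ^ 2) D * invPoch (q ^ 2) D) * (1 - q)⁻¹ := by
  have hp := sq_pow_succ_ne_one hq
  have h1 : 1 - q ≠ 0 := by simpa using one_sub_pow_succ_ne hq 0
  induction D with
  | zero => simp [hδ0, invPoch_zero]
  | succ D ih =>
    rw [Finset.sum_range_succ, ih, invPochSub_zero, hδ, add_zero, invPoch_succ hp D]
    field_simp
    ring

include hq0 hq in
theorem conj_odd_step (hδ : ∀ n, δ (n + 1) = q * (1 - q ^ (2 * n + 2)) * (1 - q ^ (2 * n + 3)) * δ n) :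
    (1 - q ^ (2 * r + 4)) * (∑ n ∈ Finset.range D,
        δ n * (invPochSub (q ^ 2) n (r + 1) * invPoch (q ^ 2) (n + (r + 1) + 2))) -
      q * (1 - q ^ (2 * r + 2)) *
        (∑ n ∈ Finset.range D, δ n * (invPochSub (q ^ 2) n r * invPoch (q ^ 2) (n + r + 2))) =
      -(δ D * (1 + q ^ (2 * r + 3)) *
        (invPochSub (q ^ 2) D (r + 1) * invPoch (q ^ 2) (D + r + 2))) := by
  have hp := sq_pow_succ_ne_one hq
  have hp0 := pow_ne_zero 2 hq0
  induction D with
  | zero => simp [invPochSub_of_lt _ r.succ_pos]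
  | succ D ih =>
    rw [Finset.sum_range_succ, Finset.sum_range_succ, mul_add, mul_add]
    refine (by ring : _ = _ + ((1 - q ^ (2 * r + 4)) *
        (δ D * (invPochSub (q ^ 2) D (r + 1) * invPoch (q ^ 2) (D + (r + 1) + 2))) -
      q * (1 - q ^ (2 * r + 2)) * (δ D * (invPochSub (q ^ 2) D r * invPoch (q ^ 2) (D + r + 2))))).trans
      ((congrArg (· + _) ih).trans ?_)
    rw [invPochSub_succ_succ, invPochSub_succ hp hp0, hδ, show D + (r + 1) + 2 = D + r + 2 + 1 by ring,
      show D + 1 + r + 2 = D + r + 2 + 1 by ring, invPoch_succ hp (D + r + 2)]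
    have := pow_ne_zero r hq0
    field_simp
    ring

include hq in
theorem conj_odd_zero (hδ0 : δ 0 = 1 - q)
    (hδ : ∀ n, δ (n + 1) = q * (1 - q ^ (2 * n + 2)) * (1 - q ^ (2 * n + 3)) * δ n) :
    ∑ n ∈ Finset.range D, δ n * (invPochSub (q ^ 2) n 0 * invPoch (q ^ 2) (n + 0 + 2)) =
      (1 - q ^ 2)⁻¹ - δ D * (invPoch (q ^ 2) D * invPoch (q ^ 2) (D + 1)) * (1 - q)⁻¹ := by
  have hp := sq_pow_succ_ne_one hq
  have h1 : 1 - q ≠ 0 := by simpa using one_sub_pow_succ_ne hq 0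
  induction D with
  | zero => simp [hδ0, invPoch]; field_simp; ring
  | succ D ih =>
    rw [Finset.sum_range_succ, ih, invPochSub_zero, hδ, add_zero, invPoch_succ hp (D + 1),
      invPoch_succ hp D, invPoch_succ hp (D + 1)]
    field_simp
    ring

include hq0 hq in
theorem conj_mixed_step (hδ : ∀ n, δ (n + 1) = -q * (1 - q ^ (n + 1)) * (1 + q ^ (n + 1)) * δ n) :
    (1 - q ^ (2 * r + 4)) * (∑ n ∈ Finset.range D,
        δ n * (invPochSub q n (r + 1) * invPoch q (n + (r + 1) + 2))) -
      -q * (1 - q ^ (2 * r + 2)) *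
        (∑ n ∈ Finset.range D, δ n * (invPochSub q n r * invPoch q (n + r + 2))) =
      -(δ D * (1 - q ^ (2 * r + 3)) * (invPochSub q D (r + 1) * invPoch q (D + r + 2))) := by
  induction D with
  | zero => simp [invPochSub_of_lt _ r.succ_pos]
  | succ D ih =>
    rw [Finset.sum_range_succ, Finset.sum_range_succ, mul_add, mul_add]
    refine (by ring : _ = _ + ((1 - q ^ (2 * r + 4)) *
        (δ D * (invPochSub q D (r + 1) * invPoch q (D + (r + 1) + 2))) -
      -q * (1 - q ^ (2 * r + 2)) * (δ D * (invPochSub q D r * invPoch q (D + r + 2))))).trans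
      ((congrArg (· + _) ih).trans ?_)
    rw [invPochSub_succ_succ, invPochSub_succ hq hq0, hδ, show D + (r + 1) + 2 = D + r + 2 + 1 by ring,
      show D + 1 + r + 2 = D + r + 2 + 1 by ring, invPoch_succ hq (D + r + 2)]
    have := pow_ne_zero r hq0
    field_simp
    ring

include hq in
theorem conj_mixed_zero (hδ0 : δ 0 = 1)
    (hδ : ∀ n, δ (n + 1) = -q * (1 - q ^ (n + 1)) * (1 + q ^ (n + 1)) * δ n) :
    ∑ n ∈ Finset.range D, δ n * (invPochSub q n 0 * invPoch q (n + 0 + 2)) =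
      (1 - q ^ 2)⁻¹ - δ D * (invPoch q D * invPoch q (D + 1)) * ((1 - q) * (1 - q ^ 2)⁻¹) := by
  have h1 : 1 - q ≠ 0 := by simpa using one_sub_pow_succ_ne hq 0
  have h2 : 1 - q ^ 2 ≠ 0 := one_sub_pow_succ_ne hq 1
  induction D with
  | zero => simp [hδ0, invPoch]; field_simp; ring
  | succ D ih =>
    rw [Finset.sum_range_succ, ih, invPochSub_zero, hδ, add_zero, invPoch_succ hq D,
      invPoch_succ hq (D + 1)]
    field_simp
    ring

end Exact

variable (hq0 : q ≠ 0) (hq : ∀ k, q ^ (k + 1) ≠ 1) {δ : ℕ → K}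

/-- The base `p` is separate from `q` because the lemma serves both `p = q` (for `f₅`) and `p = q²`
(for `f₁`, `f₂`, `f₇`), with smallness always measured in powers of `q`. -/
theorem conj_alternating {p : K} (hp0 : p ≠ 0) (hp : ∀ k, p ^ (k + 1) ≠ 1)
    (hpO : ∀ k, (1 - p ^ (k + 1))⁻¹ ∈ O) (hpp : p ∈ O) {D : ℕ} (hδ0 : δ 0 = 1)
    (hδ : ∀ n, δ (n + 1) = -p ^ (n + 1) * (1 - p ^ (n + 1)) * δ n) (hD : IsSmall O q D (δ D))
    {γ : ℕ → K} (hγ0 : γ 0 = 1) (hγ : ∀ r, γ (r + 1) = -p ^ (r + 1) * γ r) (r : ℕ) :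
    IsSmall O q D
      (∑ n ∈ Finset.range D, δ n * (invPochSub p n r * invPoch p (n + r + 1)) - γ r) := by
  refine isSmall_of_recurrence (O := O)
    (Γ := fun r => ∑ n ∈ Finset.range D, δ n * (invPochSub p n r * invPoch p (n + r + 1)))
    (fun r => conj_alternating_step hp0 hp D r hδ) (fun r => by rw [hγ, one_mul])
    (fun _ => one_ne_zero) (fun _ => by rw [inv_one]; exact O.one_mem)
    (fun r => O.neg_mem (O.pow_mem hpp _)) (fun r => ?_) ?_ r
  · exact (hD.mul (O.add_mem O.one_mem (O.pow_mem hpp _))).mul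
      (O.mul_mem (invPochSub_mem hpO _ _) (invPoch_mem hpO _))
  · simp only [conj_alternating_zero hp D hδ0 hδ, hγ0]
    rw [sub_sub_cancel_left]
    exact (hD.mul (O.mul_mem (invPoch_mem hpO _) (invPoch_mem hpO _))).neg

include hqO hO hq0 hq

theorem conj_even (hδ0 : δ 0 = 1)
    (hδ : ∀ n, δ (n + 1) = q * (1 - q ^ (2 * n + 1)) * (1 - q ^ (2 * n + 2)) * δ n) (D r : ℕ) :
    IsSmall O q D (∑ n ∈ Finset.range D,
      δ n * (invPochSub (q ^ 2) n r * invPoch (q ^ 2) (n + r + 1)) - q ^ r / (1 - q ^ (2 * r + 1))) := by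
  have h1 := fun k => O.sub_mem O.one_mem (O.pow_mem hqO k)
  have hpO := inv_one_sub_sq_mem hO
  have hD : IsSmall O q D (δ D) := isSmall_of_step (c := fun n => (1 - q ^ (2 * n + 1)) * (1 - q ^ (2 * n + 2)))
    (by rw [hδ0]; exact O.one_mem) (fun n => O.mul_mem (h1 _) (h1 _)) (fun n => by rw [hδ]; ring) D
  refine isSmall_of_recurrence (O := O)
    (Γ := fun r => ∑ n ∈ Finset.range D, δ n * (invPochSub (q ^ 2) n r * invPoch (q ^ 2) (n + r + 1)))
    (γ := fun r => q ^ r / (1 - q ^ (2 * r + 1)))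
    (fun r => conj_even_step hq0 hq D r hδ) (fun r => ?_)
    (fun r => one_sub_pow_succ_ne hq (2 * r + 2)) (fun r => hO (2 * r + 2))
    (fun r => O.mul_mem hqO (h1 _)) (fun r => ?_) ?_ r
  · have a := one_sub_pow_succ_ne hq (2 * r)
    have b : 1 - q ^ (2 * (r + 1) + 1) ≠ 0 := one_sub_pow_succ_ne hq (2 * r + 2)
    field_simp
    ring
  · exact (hD.mul (O.add_mem O.one_mem (O.pow_mem hqO _))).mul
      (O.mul_mem (invPochSub_mem hpO _ _) (invPoch_mem hpO _))
  · simp only [conj_even_zero hq D hδ0 hδ, pow_zero, mul_zero, zero_add, pow_one, one_div]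
    rw [sub_sub_cancel_left]
    exact ((hD.mul (O.mul_mem (invPoch_mem hpO _) (invPoch_mem hpO _))).mul
      (by simpa using hO 0)).neg

theorem conj_odd (hδ0 : δ 0 = 1 - q)
    (hδ : ∀ n, δ (n + 1) = q * (1 - q ^ (2 * n + 2)) * (1 - q ^ (2 * n + 3)) * δ n) (D r : ℕ) :
    IsSmall O q D (∑ n ∈ Finset.range D,
      δ n * (invPochSub (q ^ 2) n r * invPoch (q ^ 2) (n + r + 2)) - q ^ r / (1 - q ^ (2 * r + 2))) := by
  have h1 := fun k => O.sub_mem O.one_mem (O.pow_mem hqO k)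
  have hpO := inv_one_sub_sq_mem hO
  have hD : IsSmall O q D (δ D) := isSmall_of_step (c := fun n => (1 - q ^ (2 * n + 2)) * (1 - q ^ (2 * n + 3)))
    (by rw [hδ0]; simpa using h1 1) (fun n => O.mul_mem (h1 _) (h1 _)) (fun n => by rw [hδ]; ring) D
  refine isSmall_of_recurrence (O := O)
    (Γ := fun r => ∑ n ∈ Finset.range D, δ n * (invPochSub (q ^ 2) n r * invPoch (q ^ 2) (n + r + 2)))
    (γ := fun r => q ^ r / (1 - q ^ (2 * r + 2)))
    (fun r => conj_odd_step hq0 hq D r hδ) (fun r => ?_)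
    (fun r => one_sub_pow_succ_ne hq (2 * r + 3)) (fun r => hO (2 * r + 3))
    (fun r => O.mul_mem hqO (h1 _)) (fun r => ?_) ?_ r
  · have a := one_sub_pow_succ_ne hq (2 * r + 1)
    have b : 1 - q ^ (2 * (r + 1) + 2) ≠ 0 := one_sub_pow_succ_ne hq (2 * r + 3)
    field_simp
    ring
  · exact (hD.mul (O.add_mem O.one_mem (O.pow_mem hqO _))).mul
      (O.mul_mem (invPochSub_mem hpO _ _) (invPoch_mem hpO _))
  · simp only [conj_odd_zero hq D hδ0 hδ, pow_zero, mul_zero, zero_add, one_div]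
    rw [sub_sub_cancel_left]
    exact ((hD.mul (O.mul_mem (invPoch_mem hpO _) (invPoch_mem hpO _))).mul
      (by simpa using hO 0)).neg

theorem conj_mixed (hδ0 : δ 0 = 1)
    (hδ : ∀ n, δ (n + 1) = -q * (1 - q ^ (n + 1)) * (1 + q ^ (n + 1)) * δ n) (D r : ℕ) :
    IsSmall O q D (∑ n ∈ Finset.range D,
      δ n * (invPochSub q n r * invPoch q (n + r + 2)) - (-q) ^ r / (1 - q ^ (2 * r + 2))) := by
  have h1 := fun k => O.sub_mem O.one_mem (O.pow_mem hqO k)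
  have h2 := fun k => O.add_mem O.one_mem (O.pow_mem hqO k)
  have hD : IsSmall O q D (δ D) := isSmall_of_step (c := fun n => -((1 - q ^ (n + 1)) * (1 + q ^ (n + 1))))
    (by rw [hδ0]; exact O.one_mem) (fun n => O.neg_mem (O.mul_mem (h1 _) (h2 _)))
    (fun n => by rw [hδ]; ring) D
  refine isSmall_of_recurrence (O := O)
    (Γ := fun r => ∑ n ∈ Finset.range D, δ n * (invPochSub q n r * invPoch q (n + r + 2)))
    (γ := fun r => (-q) ^ r / (1 - q ^ (2 * r + 2)))
    (fun r => conj_mixed_step hq0 hq D r hδ) (fun r => ?_)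
    (fun r => one_sub_pow_succ_ne hq (2 * r + 3)) (fun r => hO (2 * r + 3))
    (fun r => O.mul_mem (O.neg_mem hqO) (h1 _)) (fun r => ?_) ?_ r
  · have a := one_sub_pow_succ_ne hq (2 * r + 1)
    have b : 1 - q ^ (2 * (r + 1) + 2) ≠ 0 := one_sub_pow_succ_ne hq (2 * r + 3)
    field_simp
    ring
  · exact (hD.mul (h1 _)).mul (O.mul_mem (invPochSub_mem hO _ _) (invPoch_mem hO _))
  · simp only [conj_mixed_zero hq D hδ0 hδ, pow_zero, mul_zero, zero_add, one_div]
    rw [sub_sub_cancel_left]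
    exact ((hD.mul (O.mul_mem (invPoch_mem hO _) (invPoch_mem hO _))).mul
      (O.mul_mem (by simpa using h1 1) (hO 1))).neg

end Conjugate

/-! ### Transfer to formal power series -/

section Transfer

open PowerSeries

theorem coeff_tsum_of_dvd {t : ℕ → ℤ⟦X⟧} (h : ∀ n, (X : ℤ⟦X⟧) ^ n ∣ t n) {d D : ℕ} (hD : d < D) :
    coeff d (∑' n, t n) = coeff d (∑ n ∈ Finset.range D, t n) := by
  have hs : Summable t := summable_of_dvd h
  have h1 : HasSum (fun n => coeff d (t n)) (coeff d (∑' n, t n)) :=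
    hs.hasSum.map (coeff d : ℤ⟦X⟧ →ₗ[ℤ] ℤ) (PowerSeries.WithPiTopology.continuous_coeff ℤ d)
  rw [map_sum, ← h1.tsum_eq]
  refine tsum_eq_sum fun n hn => ?_
  exact X_pow_dvd_iff.mp (h n) d (hD.trans_le (by simpa using hn))

/-- The embedding of `ℤ⟦X⟧` into its field of fractions. -/
noncomputable abbrev toFrac : ℤ⟦X⟧ →+* FractionRing ℤ⟦X⟧ := algebraMap _ _

theorem toFrac_injective : Function.Injective toFrac := IsFractionRing.injective _ _

theorem toFrac_ne_zero {g : ℤ⟦X⟧} (hg : constantCoeff g = 1) : toFrac g ≠ 0 := by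
  rw [Ne, map_eq_zero_iff _ toFrac_injective]
  rintro rfl
  simp at hg

theorem inv_toFrac_mem {g : ℤ⟦X⟧} (hg : constantCoeff g = 1) : (toFrac g)⁻¹ ∈ toFrac.range := by
  refine ⟨invOfUnit g 1, ?_⟩
  refine eq_inv_of_mul_eq_one_left ?_
  rw [← map_mul, invOfUnit_mul g 1 (by simpa using hg), map_one]

theorem toFrac_X_ne_zero : toFrac X ≠ 0 := by
  rw [Ne, map_eq_zero_iff _ toFrac_injective]
  exact X_ne_zero

theorem toFrac_X_pow_ne_one (k : ℕ) : toFrac X ^ (k + 1) ≠ 1 := by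
  rw [← map_pow, Ne, map_eq_one_iff _ toFrac_injective]
  intro h
  have := congrArg constantCoeff h
  simp at this

theorem toFrac_X_mem : toFrac X ∈ toFrac.range := ⟨X, rfl⟩

theorem inv_one_sub_toFrac_X_mem (k : ℕ) : (1 - toFrac X ^ (k + 1))⁻¹ ∈ toFrac.range := by
  rw [← map_pow, ← map_one toFrac, ← map_sub]
  exact inv_toFrac_mem (by simp)

theorem toFrac_quot {g h : ℤ⟦X⟧} (hh : constantCoeff h = 1) :
    toFrac (quot g h) = toFrac g / toFrac h := by
  rw [eq_div_iff (toFrac_ne_zero hh), ← map_mul, quot_mul hh]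

theorem toFrac_poch (a b : ℤ⟦X⟧) (n : ℕ) :
    toFrac (poch a b n) = ∏ j ∈ Finset.range n, (1 - toFrac a * toFrac b ^ j) := by
  rw [poch, map_prod]
  exact Finset.prod_congr rfl fun j _ => by rw [map_sub, map_one, map_mul, map_pow]

theorem coeff_eq_of_isSmall {g h : ℤ⟦X⟧} {d : ℕ}
    (hs : IsSmall toFrac.range (toFrac X) (d + 1) (toFrac g - toFrac h)) : coeff d g = coeff d h := by
  obtain ⟨_, ⟨y, rfl⟩, hy⟩ := hs
  rw [← map_sub, ← map_pow, ← map_mul] at hy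
  have hdvd : (X : ℤ⟦X⟧) ^ (d + 1) ∣ g - h := ⟨y, toFrac_injective hy⟩
  have := X_pow_dvd_iff.mp hdvd d d.lt_succ_self
  rw [map_sub] at this
  linarith

/-- Agreement modulo `q^(d+1)` settles the coefficient at `d`. The constant `c` absorbs the
prefactor `±q` of `f₄`, `f₆` and `f₈`. -/
theorem coeff_sum_eq_of_bailey {t w : ℕ → ℤ⟦X⟧} {W δ γ : ℕ → FractionRing ℤ⟦X⟧}
    {k : ℕ → ℕ → FractionRing ℤ⟦X⟧} {c : FractionRing ℤ⟦X⟧} (hc : c ∈ toFrac.range) {d : ℕ}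
    (hk : ∀ n r, n < r → k n r = 0)
    (hγ : ∀ r, IsSmall toFrac.range (toFrac X) (d + 1)
      (∑ n ∈ Finset.range (d + 1), δ n * k n r - γ r))
    (hW : ∀ r, W r ∈ toFrac.range)
    (ht : ∀ n, toFrac (t n) = c * (δ n * ∑ r ∈ Finset.range (n + 1), W r * k n r))
    (hw : ∀ r, toFrac (w r) = c * (W r * γ r)) :
    coeff d (∑ n ∈ Finset.range (d + 1), t n) = coeff d (∑ r ∈ Finset.range (d + 1), w r) := by
  apply coeff_eq_of_isSmall
  have h := (bailey_transform (fun n => rfl) hk hγ hW).mul hc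
  rw [map_sum, map_sum, Finset.sum_congr rfl fun n _ => ht n, Finset.sum_congr rfl fun n _ => hw n,
    ← Finset.mul_sum, ← Finset.mul_sum, ← mul_sub, mul_comm]
  exact h

/-- `∑_{-r ≤ j ≤ r+k} σ(j) q^{A(r)-B(j)}`. -/
noncomputable def thetaSum (k : ℕ) (σ : ℤ → ℤ) (A B : ℤ → ℤ) (r : ℕ) : ℤ⟦X⟧ :=
  ∑ j ∈ Finset.Icc (-(r : ℤ)) (r + k), C (σ j) * X ^ (A r - B j).toNat

/-- Old terms all gain the factor `X^c`, and one new term appears at each end of the range. The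
hypothesis `hB` ensures that `toNat` truncates nothing on the old range. -/
theorem thetaSum_succ {k : ℕ} {σ A B : ℤ → ℤ} {r c a b : ℕ} (hc : A (r + 1) = A r + c)
    (hB : ∀ j : ℤ, -(r : ℤ) ≤ j → j ≤ r + k → B j ≤ A r) (ha : A (r + 1) - B (r + 1 + k) = a)
    (hb : A (r + 1) - B (-(r + 1)) = b) :
    thetaSum k σ A B (r + 1) = X ^ c * thetaSum k σ A B r +
      (C (σ (r + 1 + k)) * X ^ a + C (σ (-(r + 1))) * X ^ b) := by
  have h : Finset.Icc (-((r + 1 : ℕ) : ℤ)) ((r + 1 : ℕ) + k : ℤ) =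
      insert ((r : ℤ) + 1 + k) (insert (-((r : ℤ) + 1)) (Finset.Icc (-(r : ℤ)) (r + k))) := by
    ext j
    simp only [Finset.mem_insert, Finset.mem_Icc]
    push_cast
    omega
  rw [thetaSum, h, Finset.sum_insert, Finset.sum_insert, ← add_assoc, add_comm, thetaSum,
    Finset.mul_sum]
  · push_cast
    rw [ha, hb, Int.toNat_natCast, Int.toNat_natCast]
    congr 1
    refine Finset.sum_congr rfl fun j hj => ?_
    rw [Finset.mem_Icc] at hj
    have := hB j hj.1 hj.2
    rw [show (A (r + 1) - B j).toNat = c + (A r - B j).toNat by omega, pow_add]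
    ring
  · simp only [Finset.mem_Icc]; omega
  · simp only [Finset.mem_insert, Finset.mem_Icc]; omega

/-- `∑_{|j| ≤ r} (-1)^j q^{2r²+r-j²}`. -/
noncomputable abbrev thetaAlt : ℕ → ℤ⟦X⟧ :=
  thetaSum 0 (fun j => (-1) ^ j.natAbs) (fun r => 2 * r ^ 2 + r) (fun j => j ^ 2)

/-- `∑_{|j| ≤ r} q^{r²-j²}`. -/
noncomputable abbrev thetaSq : ℕ → ℤ⟦X⟧ :=
  thetaSum 0 (fun _ => 1) (fun r => r ^ 2) (fun j => j ^ 2)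

/-- `∑_{|j| ≤ r} q^{r²+r-j(j+1)/2}`. -/
noncomputable abbrev thetaTri : ℕ → ℤ⟦X⟧ :=
  thetaSum 0 (fun _ => 1) (fun r => r ^ 2 + r) (fun j => j * (j + 1) / 2)

/-- `∑_{-r ≤ j ≤ r+1} (-1)^{j+1} q^{2r²+3r+1-j²}`. -/
noncomputable abbrev thetaHalf : ℕ → ℤ⟦X⟧ :=
  thetaSum 1 (fun j => -(-1) ^ j.natAbs) (fun r => 2 * r ^ 2 + 3 * r + 1) (fun j => j ^ 2)

/-- `∑_{0 ≤ i ≤ r} q^{r(r+1)/2+i(r-i)}`. -/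
noncomputable def thetaPar (r : ℕ) : ℤ⟦X⟧ :=
  ∑ i ∈ Finset.range (r + 1), X ^ (r * (r + 1) / 2 + i * (r - i))

theorem two_mul_int_triangle (j : ℤ) : 2 * (j * (j + 1) / 2) = j * (j + 1) :=
  Int.mul_ediv_cancel' (even_iff_two_dvd.1 (Int.even_mul_succ_self j))

theorem two_mul_triangle (r : ℕ) : 2 * (r * (r + 1) / 2) = r * (r + 1) :=
  Nat.mul_div_cancel' (even_iff_two_dvd.1 (Nat.even_mul_succ_self r))

theorem thetaAlt_zero : thetaAlt 0 = 1 := by simp [thetaSum]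

theorem thetaSq_zero : thetaSq 0 = 1 := by simp [thetaSum]

theorem thetaTri_zero : thetaTri 0 = 1 := by simp [thetaSum]

theorem thetaHalf_zero : thetaHalf 0 = 1 - X := by
  have : Finset.Icc (0 : ℤ) 1 = {0, 1} := by decide
  simp [thetaSum, this]
  ring

theorem thetaPar_zero : thetaPar 0 = 1 := by simp [thetaPar]

theorem thetaPar_one : thetaPar 1 = 2 * X := by
  simp [thetaPar, Finset.sum_range_succ]
  ring

theorem natAbs_neg_succ (r : ℕ) : (-((r : ℤ) + 1)).natAbs = r + 1 := by omega

theorem thetaAlt_succ (r : ℕ) : thetaAlt (r + 1) = X ^ (4 * r + 3) * thetaAlt r +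
    2 * (-1) ^ (r + 1) * X ^ ((r + 1) * (r + 2)) := by
  rw [thetaAlt, thetaSum_succ (c := 4 * r + 3) (a := (r + 1) * (r + 2)) (b := (r + 1) * (r + 2))
    (by push_cast; ring) (fun j h1 h2 => by push_cast at h2; nlinarith) (by push_cast; ring) (by push_cast; ring),
    natAbs_neg_succ, show ((r : ℤ) + 1 + (0 : ℕ)).natAbs = r + 1 by omega]
  simp only [map_pow, map_neg, map_one]
  ring

theorem thetaSq_succ (r : ℕ) : thetaSq (r + 1) = X ^ (2 * r + 1) * thetaSq r + 2 := by
  rw [thetaSq, thetaSum_succ (c := 2 * r + 1) (a := 0) (b := 0)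
    (by push_cast; ring) (fun j h1 h2 => by push_cast at h2; nlinarith) (by push_cast; ring) (by push_cast; ring)]
  simp only [map_one]
  ring

theorem thetaTri_succ (r : ℕ) : thetaTri (r + 1) = X ^ (2 * r + 2) * thetaTri r +
    X ^ ((r + 1) * (r + 2) / 2) * (1 + X ^ (r + 1)) := by
  have h1 := two_mul_triangle (r + 1)
  have h2 := two_mul_int_triangle ((r : ℤ) + 1)
  have h3 := two_mul_int_triangle (-((r : ℤ) + 1))
  have h4 : ((r : ℤ) + 1) ^ 2 + (r + 1) - (r + 1 + (0 : ℕ)) * (r + 1 + (0 : ℕ) + 1) / 2 =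
      ((r + 1) * (r + 1 + 1) / 2 : ℕ) := by
    rw [Nat.cast_zero, add_zero]
    zify at h1
    push_cast
    linarith
  have h5 : ((r : ℤ) + 1) ^ 2 + (r + 1) - -((r : ℤ) + 1) * (-(r + 1) + 1) / 2 =
      ((r + 1) * (r + 1 + 1) / 2 + (r + 1) : ℕ) := by
    zify at h1
    push_cast
    linarith
  have hB : ∀ j : ℤ, -(r : ℤ) ≤ j → j ≤ r + (0 : ℕ) → j * (j + 1) / 2 ≤ (r : ℤ) ^ 2 + r := by
    intro j h6 h7
    have := two_mul_int_triangle j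
    push_cast at h7
    nlinarith
  rw [thetaTri, thetaSum_succ (A := fun r => r ^ 2 + r) (B := fun j => j * (j + 1) / 2) (c := 2 * r + 2)
    (by push_cast; ring) hB h4 h5]
  simp only [map_one]
  ring

theorem thetaHalf_succ (r : ℕ) : thetaHalf (r + 1) = X ^ (4 * r + 5) * thetaHalf r +
    (-1) ^ (r + 1) * X ^ ((r + 1) * (r + 2)) * (1 - X ^ (2 * r + 3)) := by
  rw [thetaHalf, thetaSum_succ (c := 4 * r + 5) (a := (r + 1) * (r + 2))
    (b := (r + 1) * (r + 2) + (2 * r + 3))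
    (by push_cast; ring) (fun j h1 h2 => by push_cast at h2; nlinarith) (by push_cast; ring)
    (by push_cast; ring),
    natAbs_neg_succ, show ((r : ℤ) + 1 + (1 : ℕ)).natAbs = r + 2 by omega]
  simp only [map_pow, map_neg, map_one]
  ring

/-- The interior index `i + 1` for `r + 2` corresponds to `i` for `r`, because `(i + 1)(r + 1 - i) =
i (r - i) + r + 1`. The two end terms are equal. -/
theorem thetaPar_succ_succ (r : ℕ) : thetaPar (r + 2) = X ^ (3 * r + 4) * thetaPar r +
    2 * X ^ ((r + 2) * (r + 3) / 2) := by
  have h1 := two_mul_triangle r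
  have h2 := two_mul_triangle (r + 2)
  have h3 : (r + 2) * (r + 2 + 1) / 2 = r * (r + 1) / 2 + (2 * r + 3) := by
    have : (r + 2) * (r + 2 + 1) = r * (r + 1) + 2 * (2 * r + 3) := by ring
    omega
  rw [thetaPar, Finset.sum_range_succ, Finset.sum_range_succ', thetaPar, Finset.mul_sum]
  have h4 : ∀ i ∈ Finset.range (r + 1), (X : ℤ⟦X⟧) ^ ((r + 2) * (r + 2 + 1) / 2 +
      (i + 1) * (r + 2 - (i + 1))) = X ^ (3 * r + 4) * X ^ (r * (r + 1) / 2 + i * (r - i)) := by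
    intro i hi
    obtain ⟨s, rfl⟩ := Nat.exists_eq_add_of_le (Nat.lt_succ_iff.1 (Finset.mem_range.1 hi))
    rw [← pow_add, h3, show i + s + 2 - (i + 1) = s + 1 by omega, show i + s - i = s by omega]
    congr 1
    ring
  rw [Finset.sum_congr rfl h4]
  simp only [Nat.sub_self, mul_zero, zero_mul, add_zero]
  ring

end Transfer

/-! ### Expansions of the eight series as double sums -/

section Expansions

open PowerSeries

theorem poch_succ (a b : ℤ⟦X⟧) (n : ℕ) : poch a b (n + 1) = poch a b n * (1 - a * b ^ n) :=
  Finset.prod_range_succ _ _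

theorem poch_sq (p : ℤ⟦X⟧) (m : ℕ) : poch (p ^ 2) (p ^ 2) m = poch p p m * poch (-p) p m := by
  rw [poch, poch, poch, ← Finset.prod_mul_distrib]
  exact Finset.prod_congr rfl fun j _ => by ring

theorem poch_odd (p : ℤ⟦X⟧) (m : ℕ) :
    poch p p (2 * m + 1) = poch p (p ^ 2) (m + 1) * poch (p ^ 2) (p ^ 2) m := by
  induction m with
  | zero => simp [poch]
  | succ m ih =>
    rw [show 2 * (m + 1) + 1 = 2 * m + 1 + 1 + 1 by ring, poch_succ, poch_succ, ih,
      poch_succ _ _ (m + 1), poch_succ (p ^ 2) (p ^ 2) m]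
    ring

theorem poch_mul_shift (p : ℤ⟦X⟧) (m k : ℕ) :
    poch p p m * poch (p ^ (m + 1)) p k = poch p p (m + k) := by
  rw [poch, poch, poch, Finset.prod_range_add]
  congr 1
  exact Finset.prod_congr rfl fun j _ => by ring

/-- Multiplied by `(p; p)_m`, both sides become `(p; p)_{2m+1}`. This factors the denominator of
`f₈`. -/
theorem poch_shift (p : ℤ⟦X⟧) (hp : constantCoeff p = 0) (m : ℕ) :
    poch (p ^ (m + 1)) p (m + 1) = poch p (p ^ 2) (m + 1) * poch (-p) p m := by
  have h0 : poch p p m ≠ 0 := by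
    intro h
    have := constantCoeff_poch hp p m
    rw [h] at this
    simp at this
  apply mul_left_cancel₀ h0
  rw [poch_mul_shift, show m + (m + 1) = 2 * m + 1 by ring, poch_odd, poch_sq]
  ring

theorem toFrac_poch_neg_q (n : ℕ) :
    toFrac (poch (-q) q n) = ∏ j ∈ Finset.range n, (1 + toFrac X ^ (j + 1)) := by
  rw [toFrac_poch]
  exact Finset.prod_congr rfl fun j _ => by rw [map_neg]; ring

theorem toFrac_poch_q_sq (n : ℕ) :
    toFrac (poch q (q ^ 2) n) = ∏ j ∈ Finset.range n, (1 - toFrac X ^ (2 * j + 1)) := by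
  rw [toFrac_poch]
  exact Finset.prod_congr rfl fun j _ => by rw [map_pow]; ring

theorem constantCoeff_q : constantCoeff q = 0 := constantCoeff_X

theorem constantCoeff_poch_q (n : ℕ) : constantCoeff (poch q q n) = 1 :=
  constantCoeff_poch constantCoeff_q _ _

theorem constantCoeff_poch_neg_q (n : ℕ) : constantCoeff (poch (-q) q n) = 1 :=
  constantCoeff_poch (by simp) _ _

theorem triangle_sq_succ (n : ℕ) : ((n + 1) ^ 2 + (n + 1)) / 2 = (n ^ 2 + n) / 2 + (n + 1) := by
  rw [show (n + 1) ^ 2 + (n + 1) = n ^ 2 + n + (n + 1) * 2 by ring]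
  omega

theorem mem_toFrac_range (g : ℤ⟦X⟧) : toFrac g ∈ toFrac.range := ⟨g, rfl⟩

theorem isSmall_toFrac {g : ℤ⟦X⟧} {D : ℕ} (h : (X : ℤ⟦X⟧) ^ D ∣ g) :
    IsSmall toFrac.range (toFrac X) D (toFrac g) := by
  obtain ⟨y, rfl⟩ := h
  exact ⟨toFrac y, ⟨y, rfl⟩, by rw [map_mul, map_pow]⟩

theorem sum_theta_alt (n : ℕ) :
    toFrac (poch (-q) q (2 * n + 1)) * ∑ r ∈ Finset.range (n + 1),
      toFrac (thetaAlt r * (1 - X ^ (2 * r + 1))) *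
        (invPochSub (toFrac X ^ 2) n r * invPoch (toFrac X ^ 2) (n + r + 1)) = 1 := by
  have h := bailey_neg_odd toFrac_X_ne_zero toFrac_X_pow_ne_one (fun r => toFrac (thetaAlt r))
    (by simp only [thetaAlt_zero, map_one]) (fun r => by
      simp only [thetaAlt_succ, map_add, map_mul, map_pow, map_neg, map_one, map_ofNat]) n
  rw [toFrac_poch_neg_q]
  simpa only [map_mul, map_sub, map_one, map_pow] using h

/-- Combines `bailey_neg_odd` with `conj_even`; the factor `1 - q^(2r+1)` of `W` cancels the
denominator of `γ`. -/
theorem coeff_f₃ (d : ℕ) :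
    coeff d f₃ = coeff d (∑ r ∈ Finset.range (d + 1), X ^ r * thetaAlt r) := by
  rw [f₃, coeff_tsum_of_dvd (t := term3) (fun n => dvd_mul_left _ _) d.lt_succ_self]
  refine coeff_sum_eq_of_bailey (c := 1) (δ := fun n => toFrac (poch q q (2 * n) * q ^ n))
    (W := fun r => toFrac (thetaAlt r * (1 - X ^ (2 * r + 1))))
    (γ := fun r => toFrac X ^ r / (1 - toFrac X ^ (2 * r + 1)))
    (k := fun n r => invPochSub (toFrac X ^ 2) n r * invPoch (toFrac X ^ 2) (n + r + 1))
    (Subring.one_mem _) (fun n r h => by rw [invPochSub_of_lt _ h, zero_mul])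
    (conj_even toFrac_X_mem inv_one_sub_toFrac_X_mem toFrac_X_ne_zero toFrac_X_pow_ne_one
      (by simp [poch]) (fun n => ?_) (d + 1)) (fun r => mem_toFrac_range _) (fun n => ?_) (fun r => ?_)
  · rw [show 2 * (n + 1) = 2 * n + 1 + 1 by ring, poch_succ, poch_succ]
    simp only [map_mul, map_sub, map_one, map_pow]
    ring
  · have h0 := toFrac_ne_zero (constantCoeff_poch_neg_q (2 * n + 1))
    rw [eq_inv_of_mul_eq_one_right (sum_theta_alt n), term3, map_mul,
      toFrac_quot (constantCoeff_poch_neg_q _), map_mul]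
    field_simp
  · have := one_sub_pow_succ_ne toFrac_X_pow_ne_one (2 * r)
    simp only [map_mul, map_sub, map_one, map_pow]
    field_simp

/-- Combines `bailey_neg_even` with `conj_odd`. -/
theorem coeff_f₄ (d : ℕ) :
    coeff d f₄ = coeff d (∑ r ∈ Finset.range (d + 1), X ^ (r + 1) * thetaHalf r) := by
  rw [f₄, coeff_tsum_of_dvd (t := term4)
    (fun n => (pow_dvd_pow q (Nat.le_succ n)).mul_left _) d.lt_succ_self]
  refine coeff_sum_eq_of_bailey (c := toFrac X) (δ := fun n => toFrac (poch q q (2 * n + 1) * q ^ n))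
    (W := fun r => toFrac (thetaHalf r * (1 - X ^ (2 * r + 2))))
    (γ := fun r => toFrac X ^ r / (1 - toFrac X ^ (2 * r + 2)))
    (k := fun n r => invPochSub (toFrac X ^ 2) n r * invPoch (toFrac X ^ 2) (n + r + 2))
    toFrac_X_mem (fun n r h => by rw [invPochSub_of_lt _ h, zero_mul])
    (conj_odd toFrac_X_mem inv_one_sub_toFrac_X_mem toFrac_X_ne_zero toFrac_X_pow_ne_one
      (by simp [poch]) (fun n => ?_) (d + 1)) (fun r => mem_toFrac_range _) (fun n => ?_) (fun r => ?_)
  · rw [show 2 * (n + 1) + 1 = 2 * n + 1 + 1 + 1 by ring, poch_succ, poch_succ]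
    simp only [map_mul, map_sub, map_one, map_pow]
    ring
  · have h0 := toFrac_ne_zero (constantCoeff_poch_neg_q (2 * n + 2))
    have h := bailey_neg_even toFrac_X_ne_zero toFrac_X_pow_ne_one (fun r => toFrac (thetaHalf r))
      (by simp only [thetaHalf_zero, map_one, map_sub]) (fun r => by
        simp only [thetaHalf_succ, map_add, map_mul, map_pow, map_neg, map_one, map_sub]) n
    rw [← toFrac_poch_neg_q] at h
    simp only [map_mul, map_sub, map_one, map_pow]
    rw [eq_inv_of_mul_eq_one_right h, term4, map_mul,
      toFrac_quot (constantCoeff_poch_neg_q _), map_pow]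
    field_simp
    ring
  · have := one_sub_pow_succ_ne toFrac_X_pow_ne_one (2 * r + 1)
    simp only [map_mul, map_sub, map_one, map_pow]
    field_simp
    ring

/-- Combines `bailey_odd` with `conj_alternating` at base `q`; the signs in `W` and `γ` cancel. -/
theorem coeff_f₅ (d : ℕ) :
    coeff d f₅ = coeff d (∑ r ∈ Finset.range (d + 1), X ^ ((r ^ 2 + r) / 2) * thetaTri r) := by
  rw [f₅, coeff_tsum_of_dvd (t := term5)
    (fun n => (pow_dvd_pow q (le_half n)).mul_left _) d.lt_succ_self]
  refine coeff_sum_eq_of_bailey (c := 1)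
    (δ := fun n => toFrac ((-1) ^ n * poch q q n * q ^ ((n ^ 2 + n) / 2)))
    (W := fun r => (-1) ^ r * toFrac (thetaTri r))
    (γ := fun r => (-1) ^ r * toFrac X ^ ((r ^ 2 + r) / 2))
    (k := fun n r => invPochSub (toFrac X) n r * invPoch (toFrac X) (n + r + 1))
    (Subring.one_mem _) (fun n r h => by rw [invPochSub_of_lt _ h, zero_mul])
    (conj_alternating toFrac_X_ne_zero toFrac_X_pow_ne_one inv_one_sub_toFrac_X_mem toFrac_X_mem
      (by simp [poch]) (fun n => ?_) (isSmall_toFrac ((pow_dvd_pow q (le_half _)).mul_left _))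
      (by simp) (fun r => ?_))
    (fun r => Subring.mul_mem _ (Subring.pow_mem _ (Subring.neg_mem _ (Subring.one_mem _)) _)
      (mem_toFrac_range _)) (fun n => ?_) (fun r => ?_)
  · rw [triangle_sq_succ, poch_succ]
    simp only [map_mul, map_sub, map_one, map_pow, map_neg]
    ring
  · rw [triangle_sq_succ]
    ring
  · have h0 := toFrac_ne_zero (constantCoeff_poch constantCoeff_q (q ^ 2) (n + 1))
    have h := bailey_odd toFrac_X_ne_zero toFrac_X_pow_ne_one (fun r => toFrac (thetaTri r))
      (by simp only [thetaTri_zero, map_one]) (fun r => by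
        simp only [thetaTri_succ, map_add, map_mul, map_pow, map_one]) n
    rw [← toFrac_poch_q_sq] at h
    simp only [map_mul, map_neg, map_one, map_pow]
    rw [eq_inv_of_mul_eq_one_right h, term5, map_mul, map_mul,
      toFrac_quot (constantCoeff_poch constantCoeff_q _ _), map_pow, map_pow, map_neg, map_one]
    field_simp
  · simp only [map_mul, map_pow]
    rw [mul_mul_mul_comm, ← mul_pow]
    simp [mul_comm]

/-- Combines `bailey_mixed` with `conj_mixed`, after `(q)_{2n+1} = (q; q²)_{n+1} (q²; q²)_n` reduces
the term to `(q)_n / (q; q²)_{n+1}` up to sign and power of `q`. -/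
theorem coeff_f₆ (d : ℕ) :
    coeff d f₆ = coeff d (∑ r ∈ Finset.range (d + 1), -(X ^ (r + 1) * thetaPar r)) := by
  rw [f₆, coeff_tsum_of_dvd (t := fun m => term6 (m + 1))
    (fun n => (pow_dvd_pow q (Nat.le_succ n)).mul_left _) d.lt_succ_self]
  refine coeff_sum_eq_of_bailey (c := -toFrac X)
    (δ := fun n => toFrac ((-q) ^ n * poch q q n * poch (-q) q n))
    (W := fun r => (-1) ^ r * toFrac (thetaPar r) * (1 - toFrac X ^ (2 * r + 2)))
    (γ := fun r => (-toFrac X) ^ r / (1 - toFrac X ^ (2 * r + 2)))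
    (k := fun n r => invPochSub (toFrac X) n r * invPoch (toFrac X) (n + r + 2))
    (Subring.neg_mem _ toFrac_X_mem) (fun n r h => by rw [invPochSub_of_lt _ h, zero_mul])
    (conj_mixed toFrac_X_mem inv_one_sub_toFrac_X_mem toFrac_X_ne_zero toFrac_X_pow_ne_one
      (by simp [poch]) (fun n => ?_) (d + 1))
    (fun r => ⟨(-1) ^ r * thetaPar r * (1 - X ^ (2 * r + 2)), by simp⟩) (fun n => ?_) (fun r => ?_)
  · rw [poch_succ, poch_succ]
    simp only [map_mul, map_sub, map_one, map_pow, map_neg]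
    ring
  · have h0 := toFrac_ne_zero (constantCoeff_poch constantCoeff_q (q ^ 2) (n + 1))
    have h1 := toFrac_ne_zero (constantCoeff_poch_q n)
    have h2 := toFrac_ne_zero (constantCoeff_poch_neg_q n)
    have h := bailey_mixed toFrac_X_ne_zero toFrac_X_pow_ne_one (fun r => toFrac (thetaPar r))
      (by simp only [thetaPar_zero, map_one]) (by simp only [thetaPar_one, map_mul, map_ofNat])
      (fun r => by simp only [thetaPar_succ_succ, map_add, map_mul, map_pow, map_ofNat]) n
    rw [← toFrac_poch_q_sq, ← toFrac_poch_neg_q] at h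
    simp only [map_mul, map_neg, map_pow]
    rw [eq_inv_of_mul_eq_one_right h, term6, Nat.add_sub_cancel,
      show 2 * (n + 1) - 1 = 2 * n + 1 by omega, map_mul, map_mul,
      toFrac_quot (constantCoeff_poch_q _), poch_odd, poch_sq, map_mul, map_mul, map_mul, map_mul,
      map_pow, map_pow, map_neg, map_one, neg_pow (toFrac X) n]
    field_simp
    ring
  · have := one_sub_pow_succ_ne toFrac_X_pow_ne_one (2 * r + 1)
    have h1 : ((-1 : FractionRing ℤ⟦X⟧) ^ r) * (-1) ^ r = 1 := by rw [← mul_pow]; simp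
    simp only [map_mul, map_neg, map_pow]
    rw [neg_pow (toFrac X) r]
    field_simp
    linear_combination toFrac X ^ r * toFrac X * toFrac (thetaPar r) * h1

theorem conj_alternating_q_sq (d r : ℕ) :
    IsSmall toFrac.range (toFrac X) (d + 1) (∑ n ∈ Finset.range (d + 1),
      toFrac ((-1) ^ n * q ^ (n ^ 2 + n) * poch (q ^ 2) (q ^ 2) n) *
        (invPochSub (toFrac X ^ 2) n r * invPoch (toFrac X ^ 2) (n + r + 1)) -
      (-1) ^ r * toFrac X ^ (r ^ 2 + r)) := by
  refine conj_alternating (O := toFrac.range) (q := toFrac X) (p := toFrac X ^ 2)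
    (δ := fun n => toFrac ((-1) ^ n * q ^ (n ^ 2 + n) * poch (q ^ 2) (q ^ 2) n))
    (γ := fun r => (-1) ^ r * toFrac X ^ (r ^ 2 + r))
    (pow_ne_zero _ toFrac_X_ne_zero)
    (sq_pow_succ_ne_one toFrac_X_pow_ne_one) (inv_one_sub_sq_mem inv_one_sub_toFrac_X_mem)
    (Subring.pow_mem _ toFrac_X_mem _) (by simp [poch]) (fun n => ?_)
    (isSmall_toFrac (((pow_dvd_pow q (Nat.le_add_left _ _)).mul_left _).mul_right _)) (by simp)
    (fun r => by ring) r
  rw [poch_succ]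
  simp only [map_mul, map_sub, map_one, map_pow, map_neg]
  ring

/-- The Bailey pair of `f₃` with the alternating conjugate pair; here the factor `1 - q^(2r+1)`
survives. -/
theorem coeff_f₇ (d : ℕ) :
    coeff d f₇ = coeff d (∑ r ∈ Finset.range (d + 1),
      (-1) ^ r * X ^ (r ^ 2 + r) * (1 - X ^ (2 * r + 1)) * thetaAlt r) := by
  rw [f₇, coeff_tsum_of_dvd (t := term7) (fun n =>
    (((pow_dvd_pow q (Nat.le_add_left n (n ^ 2))).mul_right _).mul_right _).mul_left _)
    d.lt_succ_self]
  refine coeff_sum_eq_of_bailey (c := 1)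
    (δ := fun n => toFrac ((-1) ^ n * q ^ (n ^ 2 + n) * poch (q ^ 2) (q ^ 2) n))
    (W := fun r => toFrac (thetaAlt r * (1 - X ^ (2 * r + 1))))
    (γ := fun r => (-1) ^ r * toFrac X ^ (r ^ 2 + r))
    (k := fun n r => invPochSub (toFrac X ^ 2) n r * invPoch (toFrac X ^ 2) (n + r + 1))
    (Subring.one_mem _) (fun n r h => by rw [invPochSub_of_lt _ h, zero_mul])
    (conj_alternating_q_sq d) (fun r => mem_toFrac_range _) (fun n => ?_) (fun r => ?_)
  · have h0 := toFrac_ne_zero (constantCoeff_poch_neg_q (2 * n + 1))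
    rw [eq_inv_of_mul_eq_one_right (sum_theta_alt n), term7, map_mul,
      toFrac_quot (constantCoeff_poch_neg_q _)]
    simp only [map_mul]
    field_simp
  · simp only [map_mul, map_sub, map_one, map_pow, map_neg]
    ring

/-- Combines `bailey_mixed` at `q²`, hence the `expand`, with `conj_odd`. Of `1 - q^(4r+4)` only `1
+ q^(2r+2)` survives the denominator of `γ`. -/
theorem coeff_f₈ (d : ℕ) :
    coeff d f₈ = coeff d (∑ r ∈ Finset.range (d + 1),
      (-1) ^ r * X ^ (r + 1) * (1 + X ^ (2 * r + 2)) * expand 2 two_ne_zero (thetaPar r)) := by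
  rw [f₈, coeff_tsum_of_dvd (t := fun m => term8 (m + 1))
    (fun n => (pow_dvd_pow q (Nat.le_succ n)).mul_left _) d.lt_succ_self]
  refine coeff_sum_eq_of_bailey (c := toFrac X) (δ := fun n => toFrac (poch q q (2 * n + 1) * q ^ n))
    (W := fun r => (-1) ^ r * toFrac (expand 2 two_ne_zero (thetaPar r)) *
      (1 - (toFrac X ^ 2) ^ (2 * r + 2)))
    (γ := fun r => toFrac X ^ r / (1 - toFrac X ^ (2 * r + 2)))
    (k := fun n r => invPochSub (toFrac X ^ 2) n r * invPoch (toFrac X ^ 2) (n + r + 2))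
    toFrac_X_mem (fun n r h => by rw [invPochSub_of_lt _ h, zero_mul])
    (conj_odd toFrac_X_mem inv_one_sub_toFrac_X_mem toFrac_X_ne_zero toFrac_X_pow_ne_one
      (by simp [poch]) (fun n => ?_) (d + 1))
    (fun r => ⟨(-1) ^ r * expand 2 two_ne_zero (thetaPar r) * (1 - (X ^ 2) ^ (2 * r + 2)), by simp⟩)
    (fun n => ?_) (fun r => ?_)
  · rw [show 2 * (n + 1) + 1 = 2 * n + 1 + 1 + 1 by ring, poch_succ, poch_succ]
    simp only [map_mul, map_sub, map_one, map_pow]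
    ring
  · have hc : constantCoeff (q ^ 2 : ℤ⟦X⟧) = 0 := by simp
    have hc' : constantCoeff (-q ^ 2 : ℤ⟦X⟧) = 0 := by simp
    have h0 := toFrac_ne_zero (constantCoeff_poch hc ((q ^ 2) ^ 2) (n + 1))
    have h2 := toFrac_ne_zero (constantCoeff_poch hc' (q ^ 2) n)
    have h := bailey_mixed (pow_ne_zero 2 toFrac_X_ne_zero) (sq_pow_succ_ne_one toFrac_X_pow_ne_one)
      (fun r => toFrac (expand 2 two_ne_zero (thetaPar r)))
      (by simp only [thetaPar_zero, map_one])
      (by simp only [thetaPar_one, map_mul, map_ofNat, expand_X, map_pow])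
      (fun r => by
        simp only [thetaPar_succ_succ, map_add, map_mul, map_pow, map_ofNat, expand_X]) n
    have e1 : ∏ j ∈ Finset.range (n + 1), (1 - (toFrac X ^ 2) ^ (2 * j + 1)) =
        toFrac (poch (q ^ 2) ((q ^ 2) ^ 2) (n + 1)) := by
      rw [toFrac_poch]
      exact Finset.prod_congr rfl fun j _ => by simp only [map_pow]; ring
    have e2 : ∏ j ∈ Finset.range n, (1 + (toFrac X ^ 2) ^ (j + 1)) =
        toFrac (poch (-q ^ 2) (q ^ 2) n) := by
      rw [toFrac_poch]
      exact Finset.prod_congr rfl fun j _ => by simp only [map_pow, map_neg]; ring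
    rw [e1, e2] at h
    have e3 : poch (q ^ (2 * (n + 1))) (q ^ 2) (n + 1) =
        poch (q ^ 2) ((q ^ 2) ^ 2) (n + 1) * poch (-q ^ 2) (q ^ 2) n := by
      rw [pow_mul, poch_shift _ hc]
    have h3 : constantCoeff (poch (q ^ (2 * (n + 1))) (q ^ 2) (n + 1)) = 1 :=
      constantCoeff_poch (by simp) _ _
    rw [eq_inv_of_mul_eq_one_right h, term8, map_mul, toFrac_quot h3, e3, map_mul, map_pow, map_mul,
      map_pow, show 2 * (n + 1) - 1 = 2 * n + 1 by omega]
    field_simp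
    ring
  · have := one_sub_pow_succ_ne toFrac_X_pow_ne_one (2 * r + 1)
    simp only [map_mul, map_neg, map_pow, map_add, map_one]
    field_simp
    ring

/-- The `n`-th term of `f₁(q²) + f₂(q²) / q`. -/
noncomputable def termSum (n : ℕ) : ℤ⟦X⟧ :=
  quot (q ^ (n ^ 2 + n)) (poch (-q ^ 2) (q ^ 2) n * (1 - q ^ (2 * n + 1)))

theorem constantCoeff_termSum (n : ℕ) :
    constantCoeff (poch (-q ^ 2) (q ^ 2) n * (1 - q ^ (2 * n + 1))) = 1 := by
  rw [map_mul, constantCoeff_poch (by simp)]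
  simp

/-- Combines `bailey_alternating` with the alternating conjugate pair; `(q²; q²)_n` in `δ_n` cancels
part of `(q⁴; q⁴)_n`. -/
theorem coeff_sum_termSum (d : ℕ) :
    coeff d (∑ n ∈ Finset.range (d + 1), termSum n) = coeff d (∑ r ∈ Finset.range (d + 1),
      X ^ (r ^ 2 + r) * (1 + X ^ (2 * r + 1)) * thetaSq r) := by
  refine coeff_sum_eq_of_bailey (c := 1)
    (δ := fun n => toFrac ((-1) ^ n * q ^ (n ^ 2 + n) * poch (q ^ 2) (q ^ 2) n))
    (W := fun r => (-1) ^ r * toFrac (thetaSq r) * (1 + toFrac X ^ (2 * r + 1)))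
    (γ := fun r => (-1) ^ r * toFrac X ^ (r ^ 2 + r))
    (k := fun n r => invPochSub (toFrac X ^ 2) n r * invPoch (toFrac X ^ 2) (n + r + 1))
    (Subring.one_mem _) (fun n r h => by rw [invPochSub_of_lt _ h, zero_mul])
    (conj_alternating_q_sq d)
    (fun r => ⟨(-1) ^ r * thetaSq r * (1 + X ^ (2 * r + 1)), by simp⟩) (fun n => ?_) (fun r => ?_)
  · have h := bailey_alternating toFrac_X_ne_zero toFrac_X_pow_ne_one (fun r => toFrac (thetaSq r))
      (by simp only [thetaSq_zero, map_one]) (fun r => by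
        simp only [thetaSq_succ, map_add, map_mul, map_pow, map_ofNat]) n
    have hc' : constantCoeff (-q ^ 2 : ℤ⟦X⟧) = 0 := by simp
    have h0 := toFrac_ne_zero (constantCoeff_poch hc' (q ^ 2) n)
    have h1 := one_sub_pow_succ_ne toFrac_X_pow_ne_one (2 * n)
    have e1 : ∏ j ∈ Finset.range n, (1 - toFrac X ^ (4 * (j + 1))) =
        toFrac (poch (q ^ 2) (q ^ 2) n) * toFrac (poch (-q ^ 2) (q ^ 2) n) := by
      rw [toFrac_poch, toFrac_poch, ← Finset.prod_mul_distrib]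
      exact Finset.prod_congr rfl fun j _ => by simp only [map_pow, map_neg]; ring
    rw [e1] at h
    rw [termSum, toFrac_quot (constantCoeff_termSum n), map_mul, div_eq_iff (mul_ne_zero h0 (by
      simpa only [map_sub, map_one, map_pow] using h1))]
    simp only [map_mul, map_sub, map_one, map_pow, map_neg]
    have h2 : ((-1 : FractionRing ℤ⟦X⟧) ^ n) * (-1) ^ n = 1 := by rw [← mul_pow]; simp
    linear_combination (-(-1) ^ n * toFrac X ^ (n ^ 2 + n)) * h - toFrac X ^ (n ^ 2 + n) * h2
  · have h1 : ((-1 : FractionRing ℤ⟦X⟧) ^ r) * (-1) ^ r = 1 := by rw [← mul_pow]; simp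
    simp only [map_mul, map_pow, map_add, map_one]
    linear_combination (-toFrac X ^ (r ^ 2 + r) * (1 + toFrac X ^ (2 * r + 1)) *
      toFrac (thetaSq r)) * h1

theorem expand_poch (a b : ℤ⟦X⟧) (n : ℕ) : expand 2 two_ne_zero (poch a b n) =
    poch (expand 2 two_ne_zero a) (expand 2 two_ne_zero b) n := by
  rw [poch, poch, map_prod]
  exact Finset.prod_congr rfl fun j _ => by simp only [map_sub, map_one, map_mul, map_pow]

theorem quot_eq_of_mul_eq {g h y : ℤ⟦X⟧} (hh : constantCoeff h = 1) (e : y * h = g) :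
    y = quot g h := by
  have h0 : h ≠ 0 := by rintro rfl; simp at hh
  exact mul_right_cancel₀ h0 (e.trans (quot_mul hh).symm)

theorem term1_eq (n : ℕ) :
    term1 n = quot (q ^ ((n ^ 2 + n) / 2)) (poch (-q) q n * (1 - q ^ (2 * n + 1))) := by
  have h1 : constantCoeff (poch (-q) q n * poch q q (2 * n + 1)) = 1 := by
    rw [map_mul, constantCoeff_poch_q, constantCoeff_poch_neg_q, one_mul]
  have h0 : poch q q (2 * n) ≠ 0 := by
    intro h
    have := constantCoeff_poch_q (2 * n)
    rw [h] at this
    simp at this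
  refine quot_eq_of_mul_eq (by rw [map_mul, constantCoeff_poch_neg_q]; simp) ?_
  apply mul_right_cancel₀ h0
  have e : term1 n * _ = _ := quot_mul h1
  rw [poch_succ] at e
  linear_combination e

theorem term2_eq (n : ℕ) : term2 (n + 1) =
    quot (q ^ ((n ^ 2 + n) / 2 + (n + 1))) (poch (-q) q n * (1 - q ^ (2 * n + 1))) := by
  have h1 : constantCoeff (poch (-q) q n * poch q q (2 * n + 1)) = 1 := by
    rw [map_mul, constantCoeff_poch_q, constantCoeff_poch_neg_q, one_mul]
  have h0 : poch q q (2 * n) ≠ 0 := by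
    intro h
    have := constantCoeff_poch_q (2 * n)
    rw [h] at this
    simp at this
  refine quot_eq_of_mul_eq (by rw [map_mul, constantCoeff_poch_neg_q]; simp) ?_
  apply mul_right_cancel₀ h0
  have e := quot_mul (g := q ^ (((n + 1) ^ 2 + (n + 1)) / 2) * poch q q (2 * n)) h1
  rw [term2, Nat.add_sub_cancel, show 2 * (n + 1) - 2 = 2 * n by omega,
    show 2 * (n + 1) - 1 = 2 * n + 1 by omega]
  rw [← triangle_sq_succ]
  generalize quot _ _ = y at e ⊢
  rw [poch_succ] at e
  linear_combination e

/-- From `1 / (1 - q^(2n+1)) = (1 + q^(2n+1)) / (1 - q^(4n+2))`: the two summands of the numerator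
are the even and odd parts. -/
theorem X_mul_termSum (n : ℕ) : X * termSum n =
    X * expand 2 two_ne_zero (term1 n) + expand 2 two_ne_zero (term2 (n + 1)) := by
  have hc : constantCoeff (poch (-q) q n * (1 - q ^ (2 * n + 1))) = 1 := by
    rw [map_mul, constantCoeff_poch_neg_q]; simp
  have e1 := congrArg (expand 2 two_ne_zero) (quot_mul (g := q ^ ((n ^ 2 + n) / 2)) hc)
  have e2 := congrArg (expand 2 two_ne_zero) (quot_mul (g := q ^ ((n ^ 2 + n) / 2 + (n + 1))) hc)
  rw [← term1_eq] at e1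
  rw [← term2_eq] at e2
  have e3 := quot_mul (g := q ^ (n ^ 2 + n)) (constantCoeff_termSum n)
  rw [← termSum] at e3
  simp only [map_mul, map_sub, map_one, map_pow, expand_poch, map_neg, expand_X] at e1 e2
  have h0 : poch (-q ^ 2) (q ^ 2) n * (1 - (q ^ 2) ^ (2 * n + 1)) ≠ 0 := by
    intro h
    have := congrArg constantCoeff h
    rw [map_mul, constantCoeff_poch (by simp)] at this
    simp at this
  have h1 : (q ^ 2) ^ ((n ^ 2 + n) / 2) = q ^ (n ^ 2 + n) := by
    rw [← pow_mul, Nat.mul_div_cancel' (by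
      rw [sq, ← Nat.mul_succ]; exact even_iff_two_dvd.1 (Nat.even_mul_succ_self n))]
  rw [pow_add _ ((n ^ 2 + n) / 2), h1] at e2
  rw [h1] at e1
  apply mul_right_cancel₀ h0
  linear_combination X * (1 + q ^ (2 * n + 1)) * e3 - X * e1 - e2

theorem coeff_X_mul_sum_termSum (D d : ℕ) :
    coeff d (X * ∑ n ∈ Finset.range D, termSum n) =
      coeff d (X * expand 2 two_ne_zero (∑ n ∈ Finset.range D, term1 n)) +
      coeff d (expand 2 two_ne_zero (∑ n ∈ Finset.range D, term2 (n + 1))) := by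
  rw [← map_add, map_sum, map_sum, Finset.mul_sum, Finset.mul_sum, ← Finset.sum_add_distrib]
  exact congrArg _ (Finset.sum_congr rfl fun n _ => X_mul_termSum n)

theorem coeff_f₁ (N : ℕ) : coeff N f₁ = coeff (2 * N) (∑ r ∈ Finset.range (2 * N + 1),
      X ^ (r ^ 2 + r) * (1 + X ^ (2 * r + 1)) * thetaSq r) := by
  rw [← coeff_sum_termSum, f₁, coeff_tsum_of_dvd (t := term1) (D := 2 * N + 1)
    (fun n => ((pow_dvd_pow q (le_half n)).mul_right _).mul_right _) (by omega),
    ← coeff_succ_X_mul (2 * N), coeff_X_mul_sum_termSum, coeff_succ_X_mul, coeff_expand_mul,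
    coeff_expand_of_not_dvd _ _ _ (by omega), add_zero]

theorem coeff_f₂ (N : ℕ) : coeff (N + 1) f₂ =
    coeff (2 * N + 1) (∑ r ∈ Finset.range (2 * N + 1 + 1),
      X ^ (r ^ 2 + r) * (1 + X ^ (2 * r + 1)) * thetaSq r) := by
  rw [← coeff_sum_termSum, f₂, coeff_tsum_of_dvd (t := fun m => term2 (m + 1)) (D := 2 * N + 1 + 1)
    (fun n => ((pow_dvd_pow q ((Nat.le_succ n).trans (le_half (n + 1)))).mul_right _).mul_right _)
    (by omega), ← coeff_succ_X_mul (2 * N + 1), coeff_X_mul_sum_termSum, coeff_succ_X_mul,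
    coeff_expand_of_not_dvd _ _ _ (by omega), zero_add, show 2 * N + 1 + 1 = 2 * (N + 1) by ring,
    coeff_expand_mul]

end Expansions

/-! ### Coefficients as numbers of lattice points in a cone -/

section ConeCounts

open PowerSeries

/-- The map `φ` is a bijection from the index pairs with exponent `d` to the cone points, and all
these pairs carry the sign `ε`. The bound `r ≤ e r j` shows that truncating at `r ≤ d` loses none of
them. -/
theorem coeff_sum_eq_coneCount {κ : Type*} {d : ℕ} {s : ℕ → Finset κ} {e : ℕ → κ → ℕ}
    {σ : ℕ → κ → ℤ} {ε m N : ℤ} (E : ℕ → κ → ℤ) (φ : ℕ → κ → ℤ × ℤ)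
    (he : ∀ r, ∀ j ∈ s r, (e r j : ℤ) = E r j)
    (hr : ∀ r, ∀ j ∈ s r, r ≤ e r j)
    (hε : ∀ r, ∀ j ∈ s r, E r j = d → σ r j = ε)
    (hmem : ∀ r, ∀ j ∈ s r, E r j = d → φ r j ∈ conePts m N)
    (hinj : ∀ r r', ∀ j ∈ s r, ∀ j' ∈ s r', φ r j = φ r' j' → r = r' ∧ j = j')
    (hsurj : ∀ v ∈ conePts m N, ∃ r, ∃ j ∈ s r, φ r j = v ∧ E r j = d) :
    coeff d (∑ r ∈ Finset.range (d + 1), ∑ j ∈ s r, C (σ r j) * (X : ℤ⟦X⟧) ^ e r j) =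
      ε * coneCount m N := by
  classical
  have h1 : coneCount m N =
      (((Finset.range (d + 1)).sigma s).filter fun x => e x.1 x.2 = d).card := by
    rw [coneCount, ← Set.ncard_coe_finset]
    symm
    refine Set.ncard_congr (fun x _ => φ x.1 x.2) ?_ ?_ ?_
    · rintro ⟨r, j⟩ hx
      simp only [Finset.coe_filter, Finset.mem_sigma, Set.mem_ofPred_eq] at hx
      exact hmem r j hx.1.2 (by rw [← he r j hx.1.2, hx.2])
    · rintro ⟨r, j⟩ ⟨r', j'⟩ hx hx' h
      simp only [Finset.coe_filter, Finset.mem_sigma, Set.mem_ofPred_eq] at hx hx'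
      obtain ⟨rfl, rfl⟩ := hinj _ _ _ hx.1.2 _ hx'.1.2 h
      rfl
    · intro v hv
      obtain ⟨r, j, hj, h2, h3⟩ := hsurj v hv
      rw [← he r j hj, Nat.cast_inj] at h3
      refine ⟨⟨r, j⟩, ?_, h2⟩
      simp only [Finset.coe_filter, Finset.mem_sigma, Set.mem_ofPred_eq, Finset.mem_range]
      exact ⟨⟨by have := hr r j hj; omega, hj⟩, h3⟩
  rw [h1, map_sum, mul_comm, ← nsmul_eq_mul, ← Finset.sum_const, Finset.sum_filter, Finset.sum_sigma]
  refine Finset.sum_congr rfl fun r _ => ?_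
  rw [map_sum]
  refine Finset.sum_congr rfl fun j hj => ?_
  rw [coeff_C_mul_X_pow]
  by_cases h : e r j = d
  · rw [if_pos h, if_pos h.symm, hε r j hj (by rw [← he r j hj, h])]
  · rw [if_neg h, if_neg (Ne.symm h)]

theorem X_pow_mul_thetaSum (a k : ℕ) (σ A B : ℤ → ℤ) (r : ℕ) :
    X ^ a * thetaSum k σ A B r =
      ∑ j ∈ Finset.Icc (-(r : ℤ)) (r + k), C (σ j) * X ^ (a + (A r - B j).toNat) := by
  rw [thetaSum, Finset.mul_sum]
  exact Finset.sum_congr rfl fun j _ => by rw [pow_add]; ring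

/-- The second index in `{0, 1}` selects a summand of `1 + c' X^a'`. -/
theorem X_pow_mul_thetaSum_add (a a' k : ℕ) (c c' : ℤ) (σ A B : ℤ → ℤ) (r : ℕ) :
    C c * X ^ a * (1 + C c' * X ^ a') * thetaSum k σ A B r =
      ∑ x ∈ Finset.Icc (-(r : ℤ)) (r + k) ×ˢ Finset.range 2,
        C (c * c' ^ x.2 * σ x.1) * X ^ (a + x.2 * a' + (A r - B x.1).toNat) := by
  rw [thetaSum, Finset.mul_sum, Finset.sum_product]
  refine Finset.sum_congr rfl fun j _ => ?_
  simp only [Finset.sum_range_succ, Finset.sum_range_zero, pow_add, map_mul, pow_zero, pow_one,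
    one_mul, mul_one, zero_mul, map_one]
  ring

theorem neg_one_pow_natAbs {j : ℤ} {d : ℕ} (h : (2 : ℤ) ∣ j - d) :
    (-1 : ℤ) ^ j.natAbs = (-1) ^ d := by
  refine neg_one_pow_congr ?_
  rw [Int.natAbs_even, ← Int.even_coe_nat, Int.even_iff, Int.even_iff]
  omega

theorem two_dvd_sq_sub (j : ℤ) : (2 : ℤ) ∣ j ^ 2 - j := by
  rw [show j ^ 2 - j = (j - 1) * (j - 1 + 1) by ring]
  exact even_iff_two_dvd.1 (Int.even_mul_succ_self _)

theorem sq_le_sq_of_mem_Icc {r : ℕ} {j : ℤ} (h : j ∈ Finset.Icc (-(r : ℤ)) (r + (0 : ℕ))) :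
    j ^ 2 ≤ (r : ℤ) ^ 2 := by
  rw [Finset.mem_Icc, Nat.cast_zero, add_zero] at h
  exact sq_le_sq' h.1 h.2

theorem coeff_f₃_eq (d : ℕ) : coeff d f₃ = (-1) ^ d * coneCount 2 (4 * d + 2) := by
  rw [coeff_f₃, Finset.sum_congr rfl fun r _ => X_pow_mul_thetaSum _ _ _ _ _ _]
  -- `2 (2r+1)² - (2j)² = 4 (2r² + 2r - j²) + 2`. Conversely, the level `4d + 2` forces `w` even and
  -- `x` odd.
  refine coeff_sum_eq_coneCount (fun r j => 2 * r ^ 2 + 2 * r - j ^ 2)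
    (fun r j => (2 * r + 1, 2 * j)) ?_ ?_ ?_ ?_ ?_ ?_
  · intro r j hj
    have h1 := sq_le_sq_of_mem_Icc hj
    have h2 := sq_nonneg (r : ℤ)
    omega
  · intro r j _
    omega
  · intro r j _ h
    have h2 := two_dvd_sq_sub j
    exact neg_one_pow_natAbs (by omega)
  · intro r j hj h
    rw [Finset.mem_Icc] at hj
    exact mem_conePts.2 ⟨by omega, by omega, by linear_combination 4 * h⟩
  · intro r r' j _ j' _ h
    simp only [Prod.mk.injEq] at h
    omega
  · rintro ⟨x, w⟩ hv
    have hx : 0 < x := (conePts_bound (by norm_num) hv).1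
    obtain ⟨h1, h2, h3⟩ := mem_conePts.1 hv
    have h4 := two_dvd_sq_sub w
    have h5 := two_dvd_sq_sub x
    obtain ⟨j, rfl⟩ : (2 : ℤ) ∣ w := by omega
    rw [mul_pow] at h3
    obtain ⟨r, rfl⟩ : ∃ r : ℕ, x = 2 * r + 1 := ⟨((x - 1) / 2).toNat, by omega⟩
    exact ⟨r, j, by rw [Finset.mem_Icc]; omega, rfl, by linarith⟩

theorem coeff_f₄_eq (d : ℕ) : coeff d f₄ = (-1) ^ (d + 1) * coneCount 2 d := by
  rw [coeff_f₄, Finset.sum_congr rfl fun r _ => X_pow_mul_thetaSum _ _ _ _ _ _]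
  refine coeff_sum_eq_coneCount (fun r j => 2 * (r + 1) ^ 2 - j ^ 2)
    (fun r j => (r + 1, j)) ?_ ?_ ?_ ?_ ?_ ?_
  · intro r j hj
    rw [Finset.mem_Icc] at hj
    have h1 : j ^ 2 ≤ ((r : ℤ) + 1) ^ 2 := sq_le_sq' (by omega) (by omega)
    have h2 : 0 ≤ 2 * (r : ℤ) ^ 2 + 3 * r + 1 - j ^ 2 := by nlinarith
    push_cast
    rw [Int.toNat_of_nonneg h2]
    ring
  · intro r j _
    omega
  · intro r j _ h
    have h2 := two_dvd_sq_sub j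
    rw [pow_succ, mul_neg_one, neg_inj]
    exact neg_one_pow_natAbs (by omega)
  · intro r j hj h
    rw [Finset.mem_Icc] at hj
    exact mem_conePts.2 ⟨by omega, by omega, h⟩
  · intro r r' j _ j' _ h
    simp only [Prod.mk.injEq] at h
    omega
  · rintro ⟨x, w⟩ hv
    have hx : 0 < x := (conePts_bound (by norm_num) hv).1
    obtain ⟨h1, h2, h3⟩ := mem_conePts.1 hv
    obtain ⟨r, rfl⟩ : ∃ r : ℕ, x = r + 1 := ⟨(x - 1).toNat, by omega⟩
    exact ⟨r, w, by rw [Finset.mem_Icc]; omega, rfl, h3⟩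

theorem coeff_f₅_eq (d : ℕ) : coeff d f₅ = coneCount 3 (8 * d + 2) := by
  rw [coeff_f₅, Finset.sum_congr rfl fun r _ => X_pow_mul_thetaSum _ _ _ _ _ _,
    ← one_mul (coneCount _ _ : ℤ)]
  have hr2 : ∀ r : ℕ, 2 * (((r : ℤ) ^ 2 + r) / 2) = (r : ℤ) ^ 2 + r := fun r => by
    have := two_dvd_sq_sub r
    omega
  -- Four times the two triangular numbers, completed to squares, gives `3 (2r+1)² - (2j+1)² = 8d +
  -- 2`.
  refine coeff_sum_eq_coneCount
    (fun r j => ((r : ℤ) ^ 2 + r) / 2 + (r ^ 2 + r) - j * (j + 1) / 2)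
    (fun r j => (2 * r + 1, 2 * j + 1)) ?_ ?_ ?_ ?_ ?_ ?_
  · intro r j hj
    have h1 := sq_le_sq_of_mem_Icc hj
    rw [Finset.mem_Icc] at hj
    have h2 := two_mul_int_triangle j
    have h3 : 0 ≤ (r : ℤ) ^ 2 + r - j * (j + 1) / 2 := by
      push_cast at hj
      nlinarith
    push_cast
    rw [Int.toNat_of_nonneg h3]
    ring
  · intro r j _
    have := le_half r
    omega
  · exact fun _ _ _ _ => rfl
  · intro r j hj h
    rw [Finset.mem_Icc] at hj
    have h2 := two_mul_int_triangle j
    have h3 := hr2 r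
    exact mem_conePts.2 ⟨by omega, by omega, by linear_combination 8 * h + 4 * h2 - 4 * h3⟩
  · intro r r' j _ j' _ h
    simp only [Prod.mk.injEq] at h
    omega
  · rintro ⟨x, w⟩ hv
    have hx : 0 < x := (conePts_bound (by norm_num) hv).1
    obtain ⟨h1, h2, h3⟩ := mem_conePts.1 hv
    have h4 := two_dvd_sq_sub w
    have h5 := two_dvd_sq_sub x
    have hodd : ¬ (2 : ℤ) ∣ x := by
      rintro ⟨x, rfl⟩
      obtain ⟨w, rfl⟩ : (2 : ℤ) ∣ w := by omega
      rw [mul_pow, mul_pow] at h3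
      omega
    obtain ⟨r, rfl⟩ : ∃ r : ℕ, x = 2 * r + 1 := ⟨((x - 1) / 2).toNat, by omega⟩
    obtain ⟨j, rfl⟩ : ∃ j : ℤ, w = 2 * j + 1 := ⟨(w - 1) / 2, by omega⟩
    have h6 := two_mul_int_triangle j
    have h7 := hr2 r
    exact ⟨r, j, by rw [Finset.mem_Icc]; omega, rfl, by linarith⟩

theorem coeff_f₆_eq (d : ℕ) : coeff d f₆ = -coneCount 3 (4 * d - 1) := by
  rw [coeff_f₆, Finset.sum_congr rfl fun r _ => show -(X ^ (r + 1) * thetaPar r) =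
    ∑ i ∈ Finset.range (r + 1), C (-1) * X ^ (r + 1 + (r * (r + 1) / 2 + i * (r - i))) by
      rw [thetaPar, Finset.mul_sum, ← Finset.sum_neg_distrib]
      exact Finset.sum_congr rfl fun i _ => by rw [pow_add, map_neg, map_one]; ring,
    neg_eq_neg_one_mul (coneCount _ _ : ℤ)]
  have he : ∀ r i : ℕ, i ∈ Finset.range (r + 1) →
      2 * ((r + 1 + (r * (r + 1) / 2 + i * (r - i)) : ℕ) : ℤ) =
        2 * (r + 1) + (r * (r + 1) + 2 * i * (r - i)) := by
    intro r i hi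
    have h1 : 2 * ((r * (r + 1) / 2 : ℕ) : ℤ) = r * (r + 1) := by exact_mod_cast two_mul_triangle r
    rw [Nat.cast_add, Nat.cast_add _ (i * (r - i)), Nat.cast_mul,
      Nat.cast_sub (Nat.lt_succ_iff.1 (Finset.mem_range.1 hi))]
    push_cast at h1 ⊢
    linear_combination h1
  -- With `x = r + 1` and `w = r - 2i`, four times the exponent minus one is `3x² - w²`. The level
  -- `4d - 1` forces `x` and `w` to have opposite parity.
  refine coeff_sum_eq_coneCount _
    (fun r i => (r + 1, r - 2 * i)) (fun _ _ _ => rfl) ?_ ?_ ?_ ?_ ?_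
  · intro r j _
    exact (Nat.le_succ r).trans (Nat.le_add_right _ _)
  · exact fun _ _ _ _ => rfl
  · intro r i hi h
    have h1 := he r i hi
    rw [h] at h1
    rw [Finset.mem_range] at hi
    exact mem_conePts.2 ⟨by omega, by omega, by linear_combination -2 * h1⟩
  · intro r r' j _ j' _ h
    simp only [Prod.mk.injEq] at h
    omega
  · rintro ⟨x, w⟩ hv
    have hx : 0 < x := (conePts_bound (by norm_num) hv).1
    obtain ⟨h1, h2, h3⟩ := mem_conePts.1 hv
    have h4 := two_dvd_sq_sub w
    have h5 := two_dvd_sq_sub x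
    obtain ⟨r, rfl⟩ : ∃ r : ℕ, x = r + 1 := ⟨(x - 1).toNat, by omega⟩
    obtain ⟨i, rfl⟩ : ∃ i : ℕ, w = r - 2 * i := ⟨((r - w) / 2).toNat, by omega⟩
    have hi : i ∈ Finset.range (r + 1) := by rw [Finset.mem_range]; omega
    exact ⟨r, i, hi, rfl, by linarith [he r i hi]⟩

theorem coeff_f₇_eq (d : ℕ) : coeff d f₇ = (-1) ^ d * coneCount 3 (9 * d + 3) := by
  rw [coeff_f₇, Finset.sum_congr rfl fun r _ =>
    (show _ = C ((-1) ^ r) * X ^ (r ^ 2 + r) * (1 + C (-1) * X ^ (2 * r + 1)) * thetaAlt r by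
      simp only [map_pow, map_neg, map_one]; ring).trans
      (X_pow_mul_thetaSum_add _ _ _ _ _ _ _ _ _)]
  -- The level `9d + 3` forces `3 ∣ w` and `3 ∤ x`; `b = 0, 1` are the classes of `x` modulo 3.
  refine coeff_sum_eq_coneCount
    (fun r x => 3 * r ^ 2 + 2 * r + x.2 * (2 * r + 1) - x.1 ^ 2)
    (fun r x => (3 * r + 1 + x.2, 3 * x.1)) ?_ ?_ ?_ ?_ ?_ ?_
  · rintro r ⟨j, b⟩ hj
    rw [Finset.mem_product] at hj
    have h1 := sq_le_sq_of_mem_Icc hj.1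
    have h2 : 0 ≤ 2 * (r : ℤ) ^ 2 + r - j ^ 2 := by nlinarith
    push_cast
    rw [Int.toNat_of_nonneg h2]
    ring
  · intro r j _
    nlinarith [Nat.zero_le (j.2 * (2 * r + 1))]
  · rintro r ⟨j, b⟩ hj h
    have h2 := two_dvd_sq_sub j
    have h3 := two_dvd_sq_sub r
    simp only [Finset.mem_product, Finset.mem_range] at hj
    dsimp only at h ⊢
    -- The exponent equation gives `j ≡ d + r + b` modulo 2, so the signs from `r` and `b` cancel.
    rw [neg_one_pow_natAbs (d := d + r + b) (by
      obtain rfl | rfl : b = 0 ∨ b = 1 := by omega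
      all_goals
        push_cast at h ⊢
        omega), pow_add, pow_add]
    have h4 : ∀ k : ℕ, ((-1 : ℤ) ^ k) * (-1) ^ k = 1 := fun k => by rw [← mul_pow]; simp
    linear_combination (-1) ^ d * ((-1) ^ r * (-1) ^ r * h4 b + h4 r)
  · rintro r ⟨j, b⟩ hj h
    simp only [Finset.mem_product, Finset.mem_Icc, Finset.mem_range] at hj
    dsimp only at h ⊢
    obtain rfl | rfl : b = 0 ∨ b = 1 := by omega
    all_goals
      push_cast at h ⊢
      exact mem_conePts.2 ⟨by omega, by omega, by linear_combination 9 * h⟩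
  · rintro r r' ⟨j, b⟩ hj ⟨j', b'⟩ hj' h
    simp only [Finset.mem_product, Finset.mem_range] at hj hj'
    simp only [Prod.mk.injEq] at h ⊢
    omega
  · rintro ⟨x, w⟩ hv
    have hx : 0 < x := (conePts_bound (by norm_num) hv).1
    obtain ⟨h1, h2, h3⟩ := mem_conePts.1 hv
    obtain ⟨j, rfl⟩ : (3 : ℤ) ∣ w :=
      Int.prime_three.dvd_of_dvd_pow (n := 2) ⟨x ^ 2 - 3 * d - 1, by linarith⟩
    rw [mul_pow] at h3
    have h4 : ¬ (3 : ℤ) ∣ x := by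
      rintro ⟨y, rfl⟩
      rw [mul_pow] at h3
      omega
    obtain ⟨r, b, hb, rfl⟩ : ∃ r b : ℕ, b < 2 ∧ x = 3 * r + 1 + b :=
      ⟨(x / 3).toNat, (x % 3 - 1).toNat, by omega, by omega⟩
    refine ⟨r, (j, b), ?_, rfl, ?_⟩
    · simp only [Finset.mem_product, Finset.mem_Icc, Finset.mem_range]
      omega
    · dsimp only
      obtain rfl | rfl : b = 0 ∨ b = 1 := by omega
      all_goals
        push_cast at h3 ⊢
        linarith

theorem coeff_sum_thetaSq (d : ℕ) : coeff d (∑ r ∈ Finset.range (d + 1),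
    X ^ (r ^ 2 + r) * (1 + X ^ (2 * r + 1)) * thetaSq r : ℤ⟦X⟧) = coneCount 2 (16 * d + 2) := by
  rw [Finset.sum_congr rfl fun r _ =>
    (show _ = C 1 * X ^ (r ^ 2 + r) * (1 + C 1 * X ^ (2 * r + 1)) * thetaSq r by
      simp only [map_one, one_mul]).trans
      (X_pow_mul_thetaSum_add _ _ _ _ _ _ _ _ _), ← one_mul (coneCount _ _ : ℤ)]
  -- The level `16d + 2` forces `x` odd and `4 ∣ w`; `b` distinguishes `x ≡ 1` from `x ≡ 3` modulo
  -- 4.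
  refine coeff_sum_eq_coneCount
    (fun r x => 2 * r ^ 2 + r + x.2 * (2 * r + 1) - x.1 ^ 2)
    (fun r x => (4 * r + 1 + 2 * x.2, 4 * x.1)) ?_ ?_ ?_ ?_ ?_ ?_
  · rintro r ⟨j, b⟩ hj
    rw [Finset.mem_product] at hj
    have h1 := sq_le_sq_of_mem_Icc hj.1
    push_cast
    rw [Int.toNat_of_nonneg (sub_nonneg.2 h1)]
    ring
  · intro r j _
    nlinarith [Nat.zero_le (j.2 * (2 * r + 1))]
  · intro r j _ _
    rw [one_pow, one_mul, one_mul]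
  · rintro r ⟨j, b⟩ hj h
    simp only [Finset.mem_product, Finset.mem_Icc, Finset.mem_range] at hj
    dsimp only at h ⊢
    obtain rfl | rfl : b = 0 ∨ b = 1 := by omega
    all_goals
      push_cast at h ⊢
      exact mem_conePts.2 ⟨by omega, by omega, by linear_combination 16 * h⟩
  · rintro r r' ⟨j, b⟩ hj ⟨j', b'⟩ hj' h
    simp only [Finset.mem_product, Finset.mem_range] at hj hj'
    simp only [Prod.mk.injEq] at h ⊢
    omega
  · rintro ⟨x, w⟩ hv
    have hx : 0 < x := (conePts_bound (by norm_num) hv).1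
    obtain ⟨h1, h2, h3⟩ := mem_conePts.1 hv
    have h4 := two_dvd_sq_sub w
    obtain ⟨w, rfl⟩ : (2 : ℤ) ∣ w := by omega
    rw [mul_pow] at h3
    have h5 := two_dvd_sq_sub x
    obtain ⟨r, b, hb, rfl⟩ : ∃ r b : ℕ, b < 2 ∧ x = 4 * r + 1 + 2 * b :=
      ⟨(x / 4).toNat, (x % 4 / 2).toNat, by omega, by omega⟩
    have h6 := two_dvd_sq_sub w
    have h7 := two_dvd_sq_sub r
    -- For odd `x` one has `2x² ≡ 2` modulo 16, so `4 ∣ w²` for the halved `w`.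
    obtain ⟨j, rfl⟩ : (2 : ℤ) ∣ w := by
      obtain rfl | rfl : b = 0 ∨ b = 1 := by omega
      all_goals
        ring_nf at h3
        omega
    refine ⟨r, (j, b), ?_, ?_, ?_⟩
    · simp only [Finset.mem_product, Finset.mem_Icc, Finset.mem_range]
      omega
    · rw [← mul_assoc]
      rfl
    · dsimp only
      obtain rfl | rfl : b = 0 ∨ b = 1 := by omega
      all_goals
        push_cast at h3 ⊢
        linarith

theorem coeff_f₁_eq (d : ℕ) : coeff d f₁ = coneCount 2 (32 * d + 2) := by
  rw [coeff_f₁, coeff_sum_thetaSq]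
  push_cast
  ring_nf

theorem coeff_succ_f₂_eq (d : ℕ) : coeff (d + 1) f₂ = coneCount 2 (32 * d + 18) := by
  rw [coeff_f₂, coeff_sum_thetaSq]
  push_cast
  ring_nf

theorem X_pow_mul_expand_thetaPar (r : ℕ) :
    (-1) ^ r * X ^ (r + 1) * (1 + X ^ (2 * r + 2)) * expand 2 two_ne_zero (thetaPar r) =
      ∑ x ∈ Finset.range (r + 1) ×ˢ Finset.range 2, C ((-1) ^ r) *
        X ^ (r + 1 + x.2 * (2 * r + 2) + (r * (r + 1) + 2 * (x.1 * (r - x.1)))) := by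
  rw [thetaPar, map_sum, Finset.mul_sum, Finset.sum_product]
  refine Finset.sum_congr rfl fun i _ => ?_
  rw [map_pow, expand_X, ← pow_mul, mul_add 2, two_mul_triangle]
  simp only [Finset.sum_range_succ, Finset.sum_range_zero, pow_add, pow_zero, pow_one,
    one_mul, mul_one, zero_mul, map_one, map_pow, map_neg]
  ring

theorem coeff_f₈_eq (d : ℕ) : coeff d f₈ = (-1) ^ (d + 1) * coneCount 3 (18 * d - 6) := by
  rw [coeff_f₈, Finset.sum_congr rfl fun r _ => X_pow_mul_expand_thetaPar r]
  refine coeff_sum_eq_coneCount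
    (fun r x => r ^ 2 + 2 * r + 1 + x.2 * (2 * r + 2) + 2 * (x.1 * (r - x.1)))
    (fun r x => (3 * r + 2 + 2 * x.2, 3 * (r - 2 * x.1))) ?_ ?_ ?_ ?_ ?_ ?_
  · rintro r ⟨i, b⟩ hi
    rw [Finset.mem_product, Finset.mem_range] at hi
    dsimp only at hi ⊢
    rw [Nat.cast_add, Nat.cast_add (r * (r + 1)), Nat.cast_mul 2, Nat.cast_mul i,
      Nat.cast_sub (Nat.lt_succ_iff.1 hi.1)]
    push_cast
    ring
  · intro r x _
    exact ((Nat.le_succ r).trans (Nat.le_add_right _ _)).trans (Nat.le_add_right _ _)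
  · rintro r ⟨i, b⟩ hi h
    rw [Finset.mem_product, Finset.mem_range, Finset.mem_range] at hi
    have h3 := two_dvd_sq_sub r
    refine neg_one_pow_congr ?_
    rw [← Int.even_coe_nat, ← Int.even_coe_nat, Int.even_iff, Int.even_iff]
    dsimp only at h hi
    obtain rfl | rfl : b = 0 ∨ b = 1 := by omega
    all_goals
      push_cast at h ⊢
      omega
  · rintro r ⟨i, b⟩ hi h
    simp only [Finset.mem_product, Finset.mem_range] at hi
    dsimp only at h ⊢
    obtain rfl | rfl : b = 0 ∨ b = 1 := by omega
    all_goals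
      push_cast at h ⊢
      exact mem_conePts.2 ⟨by omega, by omega, by linear_combination 18 * h⟩
  · rintro r r' ⟨j, b⟩ hj ⟨j', b'⟩ hj' h
    simp only [Finset.mem_product, Finset.mem_range] at hj hj'
    simp only [Prod.mk.injEq] at h ⊢
    omega
  · rintro ⟨x, w⟩ hv
    have hx : 0 < x := (conePts_bound (by norm_num) hv).1
    obtain ⟨h1, h2, h3⟩ := mem_conePts.1 hv
    obtain ⟨u, rfl⟩ : (3 : ℤ) ∣ w :=
      Int.prime_three.dvd_of_dvd_pow (n := 2) ⟨x ^ 2 - 6 * d + 2, by linarith⟩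
    rw [mul_pow] at h3
    have h4 : ¬ (3 : ℤ) ∣ x := by
      rintro ⟨y, rfl⟩
      rw [mul_pow] at h3
      omega
    -- The class `x ≡ 1` modulo 3 is parametrized by `3r + 4`, so `x = 1` must be ruled out.
    have h5 : x ≠ 1 := by
      rintro rfl
      obtain rfl : u = 0 := by omega
      omega
    have h6 := two_dvd_sq_sub x
    have h7 := two_dvd_sq_sub u
    obtain ⟨r, b, hb, rfl⟩ : ∃ r b : ℕ, b < 2 ∧ x = 3 * r + 2 + 2 * b := by
      obtain h | h : x % 3 = 2 ∨ x % 3 = 1 := by omega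
      · exact ⟨(x / 3).toNat, 0, by omega, by omega⟩
      · exact ⟨(x / 3 - 1).toNat, 1, by omega, by omega⟩
    obtain ⟨i, rfl⟩ : ∃ i : ℕ, u = r - 2 * i := ⟨((r - u) / 2).toNat, by omega⟩
    refine ⟨r, (i, b), ?_, rfl, ?_⟩
    · simp only [Finset.mem_product, Finset.mem_range]
      omega
    · dsimp only
      obtain rfl | rfl : b = 0 ∨ b = 1 := by omega
      all_goals
        push_cast at h3 ⊢
        linarith

end ConeCounts

/-! ### Values attained infinitely often -/

section Values

open PowerSeries

theorem mem_infinitelyAttained {f : ℤ⟦X⟧} {m : ℤ} (h : ∀ j : ℕ, ∃ n, j ≤ n ∧ coeff n f = m) :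
    m ∈ infinitelyAttained f :=
  Set.infinite_of_forall_exists_gt fun j => by
    obtain ⟨n, h1, h2⟩ := h (j + 1)
    exact ⟨n, h2, h1⟩

/-- A positive index suffices, which avoids the constant coefficient, not covered by the formula for
`f₂`. -/
theorem exists_of_mem_infinitelyAttained {f : ℤ⟦X⟧} {m : ℤ} (h : m ∈ infinitelyAttained f) :
    ∃ d, coeff (d + 1) f = m := by
  obtain ⟨n, h1, h2⟩ := Set.Infinite.exists_gt h 0
  obtain ⟨d, rfl⟩ := Nat.exists_eq_succ_of_ne_zero h2.ne'
  exact ⟨d, h1⟩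

theorem exists_pow_mul_pow_eq (M a b k j : ℕ) (hb : 0 < b) :
    ∃ n, j ≤ n ∧ (M * a + 1) ^ k * (M * b + 1) ^ j = M * n + 1 := by
  induction j with
  | zero =>
    induction k with
    | zero => exact ⟨0, le_rfl, rfl⟩
    | succ k ih =>
      obtain ⟨n, -, h⟩ := ih
      rw [pow_zero, mul_one] at h
      exact ⟨M * n * a + n + a, Nat.zero_le _, by rw [pow_succ, h]; ring⟩
  | succ j ih =>
    obtain ⟨n, hj, h⟩ := ih
    exact ⟨M * n * b + n + b, by nlinarith [Nat.zero_le (M * n * b)],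
      by rw [pow_succ, ← mul_assoc, h]; ring⟩

/-- `17 = 16 + 1` supplies the multiplicity, `81 = 16·5 + 1 = 9²` makes `n` large without changing
the count. -/
theorem exists_coneCount_two (k j : ℕ) {c : ℤ} (hc : 0 < c) (h17 : ¬ (17 : ℤ) ∣ c) :
    ∃ n : ℕ, j ≤ n ∧ (coneCount 2 ((16 * n + 1) * c) : ℤ) = (k + 1) * coneCount 2 c := by
  obtain ⟨n, hj, h⟩ := exists_pow_mul_pow_eq 16 1 5 k j (by norm_num)
  refine ⟨n, hj, ?_⟩
  zify at h
  rw [← h, show ((16 * 1 + 1 : ℤ) ^ k * (16 * 5 + 1) ^ j) * c = 9 ^ (2 * j) * (17 ^ k * c) by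
    rw [pow_mul]; norm_num; ring, coneCount_two_family _ _ hc h17]
  push_cast
  rfl

/-- The same with `13 = 12 + 1` and `25 = 12·2 + 1`. -/
theorem exists_coneCount_three (k j : ℕ) {c : ℤ} (hc : 0 < c) (h13 : ¬ (13 : ℤ) ∣ c) :
    ∃ n : ℕ, j ≤ n ∧ (coneCount 3 ((12 * n + 1) * c) : ℤ) = (k + 1) * coneCount 3 c := by
  obtain ⟨n, hj, h⟩ := exists_pow_mul_pow_eq 12 1 2 k j (by norm_num)
  refine ⟨n, hj, ?_⟩
  zify at h
  rw [← h, show ((12 * 1 + 1 : ℤ) ^ k * (12 * 2 + 1) ^ j) * c = 25 ^ j * (13 ^ k * c) by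
    norm_num; ring, coneCount_three_family _ _ hc h13]
  push_cast
  rfl

theorem coneCount_two_eighteen : coneCount 2 18 = 1 := by
  have h := coneCount_two_family 0 1 (N := 2) (by norm_num) (by norm_num)
  norm_num [coneCount_two_two] at h
  exact h

/-! ### Vanishing and parity of the counts -/

theorem coneCount_two_eq_zero {N : ℤ} (h1 : (3 : ℤ) ∣ N) (h2 : ¬ (9 : ℤ) ∣ N) :
    coneCount 2 N = 0 :=
  coneCount_inert_zero three_inert h1 (by norm_num [h2])

theorem coneCount_three_eq_zero {N : ℤ} (h1 : (5 : ℤ) ∣ N) (h2 : ¬ (25 : ℤ) ∣ N) :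
    coneCount 3 N = 0 :=
  coneCount_inert_zero five_inert h1 (by norm_num [h2])

/-- Modulo 4: `w = 0` would give `x² = 2d + 1 ≡ 3`, and `w = x` would give `x² = 4d + 2 ≡ 2`. -/
theorem even_coneCount_two (d : ℕ) (hd : ¬ 2 ∣ d) : Even (coneCount 2 (4 * d + 2)) := by
  refine even_coneCount (by norm_num) ?_
  rintro ⟨x, w⟩ hv
  obtain ⟨-, -, h⟩ := mem_conePts.1 hv
  have h1 : x ^ 2 % 4 = 0 ∨ x ^ 2 % 4 = 1 := by
    rcases Int.even_or_odd' x with ⟨y, rfl | rfl⟩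
    · left; ring_nf; omega
    · right; ring_nf; omega
  constructor
  · rintro rfl
    omega
  · intro hw
    dsimp only at hw
    subst hw
    omega

/-- `w = 0` would give `x² = 6d - 2 ≡ 2` modulo 4, and `w = x` would give `x² = 9d - 3`, divisible
by 3 but not by 9. -/
theorem even_coneCount_three (d : ℕ) (hd : 2 ∣ d) : Even (coneCount 3 (18 * d - 6)) := by
  refine even_coneCount (by norm_num) ?_
  rintro ⟨x, w⟩ hv
  obtain ⟨-, -, h⟩ := mem_conePts.1 hv
  constructor
  · rintro rfl
    have h1 : x ^ 2 % 4 = 0 ∨ x ^ 2 % 4 = 1 := by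
      rcases Int.even_or_odd' x with ⟨y, rfl | rfl⟩
      · left; ring_nf; omega
      · right; ring_nf; omega
    omega
  · intro hw
    dsimp only at hw
    subst hw
    obtain ⟨y, rfl⟩ : (3 : ℤ) ∣ w :=
      Int.prime_three.dvd_of_dvd_pow (n := 2) ⟨3 * d - 1, by linarith⟩
    rw [mul_pow] at h
    omega

/-! ### The eight value sets -/

theorem infinitelyAttained_f₁ : infinitelyAttained f₁ = {m : ℤ | 0 ≤ m} := by
  apply Set.Subset.antisymm
  · intro m hm
    obtain ⟨d, rfl⟩ := exists_of_mem_infinitelyAttained hm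
    rw [coeff_f₁_eq]
    exact Int.natCast_nonneg _
  · intro m hm
    refine mem_infinitelyAttained fun j => ?_
    obtain ⟨m, rfl⟩ := Int.eq_ofNat_of_zero_le hm
    cases m with
    | zero =>
      -- The level `66 + 288 j` is divisible by 3 but not by 9. The zero witnesses for the other
      -- series are chosen alike, with 5 and 25 when `m = 3`.
      refine ⟨2 + 9 * j, by omega, ?_⟩
      rw [coeff_f₁_eq, coneCount_two_eq_zero (by omega) (by omega)]
    | succ k =>
      obtain ⟨n, hj, h⟩ := exists_coneCount_two k j (c := 2) (by norm_num) (by norm_num)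
      refine ⟨n, hj, ?_⟩
      rw [coeff_f₁_eq, show 32 * (n : ℤ) + 2 = (16 * n + 1) * 2 by ring, h, coneCount_two_two]
      push_cast
      ring

theorem infinitelyAttained_f₂ : infinitelyAttained f₂ = {m : ℤ | 0 ≤ m} := by
  apply Set.Subset.antisymm
  · intro m hm
    obtain ⟨d, rfl⟩ := exists_of_mem_infinitelyAttained hm
    rw [coeff_succ_f₂_eq]
    exact Int.natCast_nonneg _
  · intro m hm
    refine mem_infinitelyAttained fun j => ?_
    obtain ⟨m, rfl⟩ := Int.eq_ofNat_of_zero_le hm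
    cases m with
    | zero =>
      refine ⟨3 + 9 * j + 1, by omega, ?_⟩
      rw [coeff_succ_f₂_eq, coneCount_two_eq_zero (by omega) (by omega)]
    | succ k =>
      obtain ⟨n, hj, h⟩ := exists_coneCount_two k j (c := 18) (by norm_num) (by norm_num)
      -- The starting level 18 gives `(16n + 1)·18 = 32·(9n) + 18`.
      refine ⟨9 * n + 1, by omega, ?_⟩
      rw [coeff_succ_f₂_eq, show 32 * ((9 * n : ℕ) : ℤ) + 18 = (16 * n + 1) * 18 by push_cast; ring,
        h, coneCount_two_eighteen]
      push_cast
      ring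

theorem infinitelyAttained_f₃ : infinitelyAttained f₃ =
    {m : ℤ | 0 ≤ m} ∪ {m : ℤ | ∃ k : ℕ, 1 ≤ k ∧ m = -2 * (k : ℤ)} := by
  apply Set.Subset.antisymm
  · intro m hm
    obtain ⟨d, rfl⟩ := exists_of_mem_infinitelyAttained hm
    rw [coeff_f₃_eq]
    by_cases hd : 2 ∣ d + 1
    · left
      rw [(even_iff_two_dvd.2 hd).neg_one_pow, one_mul]
      exact Int.natCast_nonneg _
    · obtain ⟨k, hk⟩ := even_coneCount_two _ hd
      rw [hk, (Nat.not_even_iff_odd.1 (even_iff_two_dvd.not.2 hd)).neg_one_pow]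
      rcases Nat.eq_zero_or_pos k with rfl | h
      · left; simp
      · exact Or.inr ⟨k, h, by push_cast; ring⟩
  · rintro m (hm | ⟨k, hk, rfl⟩)
    · refine mem_infinitelyAttained fun j => ?_
      obtain ⟨m, rfl⟩ := Int.eq_ofNat_of_zero_le hm
      cases m with
      | zero =>
        refine ⟨1 + 9 * j, by omega, ?_⟩
        rw [coeff_f₃_eq, coneCount_two_eq_zero (by omega) (by omega)]
        simp
      | succ k =>
        obtain ⟨n, hj, h⟩ := exists_coneCount_two k j (c := 2) (by norm_num) (by norm_num)
        refine ⟨8 * n, by omega, ?_⟩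
        rw [coeff_f₃_eq, show 4 * ((8 * n : ℕ) : ℤ) + 2 = (16 * n + 1) * 2 by push_cast; ring, h,
          coneCount_two_two, Even.neg_one_pow ⟨4 * n, by ring⟩]
        push_cast
        ring
    · obtain ⟨k, rfl⟩ := Nat.exists_eq_add_of_le' hk
      refine mem_infinitelyAttained fun j => ?_
      -- The level `14 = 4·3 + 2` has count 2 and belongs to the odd index 3, so its multiples give
      -- `-2 (k + 1)`.
      obtain ⟨n, hj, h⟩ := exists_coneCount_two k j (c := 14) (by norm_num) (by norm_num)
      refine ⟨56 * n + 3, by omega, ?_⟩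
      rw [coeff_f₃_eq, show 4 * ((56 * n + 3 : ℕ) : ℤ) + 2 = (16 * n + 1) * 14 by push_cast; ring,
        h, coneCount_two_fourteen, Odd.neg_one_pow ⟨28 * n + 1, by ring⟩]
      push_cast
      ring

theorem infinitelyAttained_f₄ : infinitelyAttained f₄ = Set.univ := by
  refine Set.eq_univ_of_forall fun m => mem_infinitelyAttained fun j => ?_
  rcases lt_trichotomy m 0 with hm | rfl | hm
  · obtain ⟨k, rfl⟩ : ∃ k : ℕ, m = -(k + 1) := ⟨(-m - 1).toNat, by omega⟩
    -- An even level gives the negative sign; the odd starting level 1 serves the positive values.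
    obtain ⟨n, hj, h⟩ := exists_coneCount_two k j (c := 2) (by norm_num) (by norm_num)
    refine ⟨32 * n + 2, by omega, ?_⟩
    rw [coeff_f₄_eq, show ((32 * n + 2 : ℕ) : ℤ) = (16 * n + 1) * 2 by push_cast; ring,
      h, coneCount_two_two, Odd.neg_one_pow ⟨16 * n + 1, by ring⟩]
    push_cast
    ring
  · refine ⟨3 + 9 * j, by omega, ?_⟩
    rw [coeff_f₄_eq, coneCount_two_eq_zero (by omega) (by omega)]
    simp
  · obtain ⟨k, rfl⟩ : ∃ k : ℕ, m = k + 1 := ⟨(m - 1).toNat, by omega⟩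
    obtain ⟨n, hj, h⟩ := exists_coneCount_two k j (c := 1) (by norm_num) (by norm_num)
    refine ⟨16 * n + 1, by omega, ?_⟩
    rw [coeff_f₄_eq, show ((16 * n + 1 : ℕ) : ℤ) = (16 * n + 1) * 1 by push_cast; ring,
      h, coneCount_two_one, Even.neg_one_pow ⟨8 * n + 1, by ring⟩]
    push_cast
    ring

theorem infinitelyAttained_f₅ : infinitelyAttained f₅ = {m : ℤ | 0 ≤ m} := by
  apply Set.Subset.antisymm
  · intro m hm
    obtain ⟨d, rfl⟩ := exists_of_mem_infinitelyAttained hm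
    rw [coeff_f₅_eq]
    exact Int.natCast_nonneg _
  · intro m hm
    refine mem_infinitelyAttained fun j => ?_
    obtain ⟨m, rfl⟩ := Int.eq_ofNat_of_zero_le hm
    cases m with
    | zero =>
      refine ⟨1 + 25 * j, by omega, ?_⟩
      rw [coeff_f₅_eq, coneCount_three_eq_zero (by omega) (by omega)]
    | succ k =>
      obtain ⟨n, hj, h⟩ := exists_coneCount_three k j (c := 2) (by norm_num) (by norm_num)
      refine ⟨3 * n, by omega, ?_⟩
      rw [coeff_f₅_eq, show 8 * ((3 * n : ℕ) : ℤ) + 2 = (12 * n + 1) * 2 by push_cast; ring,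
        h, coneCount_three_two]
      push_cast
      ring

theorem infinitelyAttained_f₆ : infinitelyAttained f₆ = {m : ℤ | m ≤ 0} := by
  apply Set.Subset.antisymm
  · intro m hm
    obtain ⟨d, rfl⟩ := exists_of_mem_infinitelyAttained hm
    rw [coeff_f₆_eq]
    exact Int.neg_nonpos_of_nonneg (Int.natCast_nonneg _)
  · intro m hm
    refine mem_infinitelyAttained fun j => ?_
    obtain ⟨k, hk⟩ := Int.eq_ofNat_of_zero_le (neg_nonneg.2 hm)
    obtain rfl := neg_eq_iff_eq_neg.1 hk
    cases k with
    | zero =>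
      refine ⟨4 + 25 * j, by omega, ?_⟩
      rw [coeff_f₆_eq, coneCount_three_eq_zero (by omega) (by omega)]
    | succ k =>
      obtain ⟨n, hj, h⟩ := exists_coneCount_three k j (c := 3) (by norm_num) (by norm_num)
      refine ⟨9 * n + 1, by omega, ?_⟩
      rw [coeff_f₆_eq, show 4 * ((9 * n + 1 : ℕ) : ℤ) - 1 = (12 * n + 1) * 3 by push_cast; ring,
        h, coneCount_three_three]
      push_cast
      ring

theorem infinitelyAttained_f₇ : infinitelyAttained f₇ = Set.univ := by
  refine Set.eq_univ_of_forall fun m => mem_infinitelyAttained fun j => ?_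
  rcases lt_trichotomy m 0 with hm | rfl | hm
  · obtain ⟨k, rfl⟩ : ∃ k : ℕ, m = -(k + 1) := ⟨(-m - 1).toNat, by omega⟩
    -- The level `12 = 9·1 + 3` sits at an odd index, giving negative values; the level 3 sits at
    -- index 0, giving positive ones.
    obtain ⟨n, hj, h⟩ := exists_coneCount_three k j (c := 12) (by norm_num) (by norm_num)
    refine ⟨16 * n + 1, by omega, ?_⟩
    rw [coeff_f₇_eq, show 9 * ((16 * n + 1 : ℕ) : ℤ) + 3 = (12 * n + 1) * 12 by push_cast; ring,
      h, coneCount_three_twelve, Odd.neg_one_pow ⟨8 * n, by ring⟩]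
    push_cast
    ring
  · refine ⟨3 + 25 * j, by omega, ?_⟩
    rw [coeff_f₇_eq, coneCount_three_eq_zero (by omega) (by omega)]
    simp
  · obtain ⟨k, rfl⟩ : ∃ k : ℕ, m = k + 1 := ⟨(m - 1).toNat, by omega⟩
    obtain ⟨n, hj, h⟩ := exists_coneCount_three k j (c := 3) (by norm_num) (by norm_num)
    refine ⟨4 * n, by omega, ?_⟩
    rw [coeff_f₇_eq, show 9 * ((4 * n : ℕ) : ℤ) + 3 = (12 * n + 1) * 3 by push_cast; ring,
      h, coneCount_three_three, Even.neg_one_pow ⟨2 * n, by ring⟩]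
    push_cast
    ring

theorem infinitelyAttained_f₈ : infinitelyAttained f₈ =
    {m : ℤ | 0 ≤ m} ∪ {m : ℤ | ∃ k : ℕ, 1 ≤ k ∧ m = -2 * (k : ℤ)} := by
  apply Set.Subset.antisymm
  · intro m hm
    obtain ⟨d, rfl⟩ := exists_of_mem_infinitelyAttained hm
    rw [coeff_f₈_eq]
    by_cases hd : 2 ∣ d + 1
    · obtain ⟨k, hk⟩ := even_coneCount_three _ hd
      rw [hk, (even_iff_two_dvd.2 hd).add_one.neg_one_pow]
      rcases Nat.eq_zero_or_pos k with rfl | h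
      · left; simp
      · exact Or.inr ⟨k, h, by push_cast; ring⟩
    · left
      rw [(Nat.not_even_iff_odd.1 (even_iff_two_dvd.not.2 hd)).add_one.neg_one_pow, one_mul]
      exact Int.natCast_nonneg _
  · rintro m (hm | ⟨k, hk, rfl⟩)
    · refine mem_infinitelyAttained fun j => ?_
      obtain ⟨m, rfl⟩ := Int.eq_ofNat_of_zero_le hm
      cases m with
      | zero =>
        refine ⟨2 + 25 * j, by omega, ?_⟩
        rw [coeff_f₈_eq, coneCount_three_eq_zero (by omega) (by omega)]
        simp
      | succ k =>
        obtain ⟨n, hj, h⟩ := exists_coneCount_three k j (c := 12) (by norm_num) (by norm_num)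
        refine ⟨8 * n + 1, by omega, ?_⟩
        rw [coeff_f₈_eq, show 18 * ((8 * n + 1 : ℕ) : ℤ) - 6 = (12 * n + 1) * 12 by push_cast; ring,
          h, coneCount_three_twelve, Even.neg_one_pow ⟨4 * n + 1, by ring⟩]
        push_cast
        ring
    · obtain ⟨k, rfl⟩ := Nat.exists_eq_add_of_le' hk
      refine mem_infinitelyAttained fun j => ?_
      -- The level `66 = 18·4 - 6` has count 2 and an even index, where the sign is negative.
      obtain ⟨n, hj, h⟩ := exists_coneCount_three k j (c := 66) (by norm_num) (by norm_num)
      refine ⟨44 * n + 4, by omega, ?_⟩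
      rw [coeff_f₈_eq, show 18 * ((44 * n + 4 : ℕ) : ℤ) - 6 = (12 * n + 1) * 66 by push_cast; ring,
        h, coneCount_three_sixtySix, Odd.neg_one_pow ⟨22 * n + 2, by ring⟩]
      push_cast
      ring

end Values

theorem corollary1p9 :
    infinitelyAttained f₁ = {m : ℤ | 0 ≤ m} ∧
    infinitelyAttained f₂ = {m : ℤ | 0 ≤ m} ∧
    infinitelyAttained f₃ = {m : ℤ | 0 ≤ m} ∪ {m : ℤ | ∃ k : ℕ, 1 ≤ k ∧ m = -2 * (k : ℤ)} ∧
    infinitelyAttained f₄ = Set.univ ∧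
    infinitelyAttained f₅ = {m : ℤ | 0 ≤ m} ∧
    infinitelyAttained f₆ = {m : ℤ | m ≤ 0} ∧
    infinitelyAttained f₇ = Set.univ ∧
    infinitelyAttained f₈ = {m : ℤ | 0 ≤ m} ∪ {m : ℤ | ∃ k : ℕ, 1 ≤ k ∧ m = -2 * (k : ℤ)} :=
  ⟨infinitelyAttained_f₁, infinitelyAttained_f₂, infinitelyAttained_f₃, infinitelyAttained_f₄,
    infinitelyAttained_f₅, infinitelyAttained_f₆, infinitelyAttained_f₇, infinitelyAttained_f₈⟩
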